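/- **Conventions.** Let $S$ be a set and let $\mathsf{BiMag}_S$ be the set of formal expressions generated from the elements of $S$ and a symbol $1$ by $X\times Y$ and $Y^X$. Let $\mathbf{CFam}_S$ be the free cartesian closed category on $S$ with no further generators: its object set is $\mathsf{BiMag}_S$, and its morphisms are generated by identities, composition, $!_X:X\to 1$, the projections $\pi_i$, the evaluations $\mathrm{ev}_{Y,Z}:Z^Y\times Y\to Z$, pairing $\langle f,g\rangle$ and currying $\lambda f$, subject to the laws of categories, of a terminal object, of binary products and of exponentials. An *$S$-sorted CCC* is a cartesian closed category $\mathbf C$ with object set $\mathsf{BiMag}_S$ together with an identity-on-objects cartesian closed functor (one preserving finite products and exponentials) $\iota:\mathbf{CFam}_S\to\mathbf C$. A morphism $(\mathbf C,\iota)\to(\mathbf C',\iota')$ in the category $\mathbf{CCC}_S$ is a cartesian closed functor $F$ with $F\circ\iota=\iota'$. The projections and evaluations of $\mathbf C$ are the images under $\iota$ of those of $\mathbf{CFam}_S$. A *natural system* $D$ on $\mathbf C$ is a functor to abelian groups from the category whose objects are the morphisms of $\mathbf C$ and whose morphisms $f\to g$ are the pairs $(a,b)$ with $g=b\circ f\circ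 a$. Write $D_f$ for its value at $f$, and $a_*=D(1,a):D_f\to D_{a\circ f}$, $a^*=D(a,1):D_f\to D_{f\circ a}$. It is *cartesian* if for every finite (possibly empty) product $P=X_1\times\dots\times X_n$ with projections $\pi_k$ and every $f:X\to P$ the map $D_f\to\prod_k D_{\pi_k\circ f}$, $\xi\mapsto(\pi_{k*}\xi)_k$, is an isomorphism. For cartesian $D$, $g:X\to W$ and an object $Y$, let $\phi_g:D_g\times D_{\pi_2}\to D_{g\times 1_Y}$ be $\pi_1^*\times 1$ followed by the inverse of $D_{g\times 1_Y}\cong D_{g\circ\pi_1}\times D_{\pi_2}$, where $\pi_1,\pi_2$ are the projections of $X\times Y$. A cartesian $D$ is *cartesian closed* if for every $f:X\times Y\to Z$ the map $D_{\lambda f}\to D_f$, $\xi\mapsto \mathrm{ev}_{Y,Z*}\,\phi_{\lambda f}(\xi,0)$, is an isomorphism. Cartesian closed natural systems on $\mathbf C$ and natural transformations form the category $\mathbf{CCNat}_{\mathbf C}$. The *trivial extension* $D\rtimes\mathbf C$ is the category with the objects of $\mathbf C$, with $\mathrm{Hom}(X,Y)=\coprod_{f:X\to Y}D_f$, with identities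 $0\in D_{1_X}$, and with $\xi\circ\eta=f_*\eta+g^*\xi\in D_{f\circ g}$ for $\xi\in D_f$, $\eta\in D_g$. A *Beck module* over $\mathbf C$ is an abelian group object $p:\mathbf E\to\mathbf C$ in the slice category $\mathbf{CCC}_S/\mathbf C$; they form the category $(\mathbf{CCC}_S/\mathbf C)_{\mathrm{ab}}$. For a morphism $f:X\to Y$ of $\mathbf C$ let $p^{-1}(f)$ be the set of morphisms $X\to Y$ of $\mathbf E$ over $f$. The group structure of $p$ provides an addition on $p^{-1}(f)$, with zero $0_f$. **Theorem.** For every set $S$ and every $S$-sorted CCC $\mathbf C$ there is an equivalence of categories $$\Xi:\mathbf{CCNat}_{\mathbf C}\xrightarrow{\ \sim\ }(\mathbf{CCC}_S/\mathbf C)_{\mathrm{ab}}$$ with the following properties. 1. Naturally in $D$, the category underlying $\Xi(D)$ is (isomorphic to) $D\rtimes\mathbf C$, with the projection $D\rtimes\mathbf C\to\mathbf C$ as structure morphism, with the functor $\mathbf{CFam}_S\to D\rtimes\mathbf C$, $f\mapsto 0\in D_{\iota(f)}$, and with the addition $(D\rtimes\mathbf C)\times_{\mathbf C}(D\rtimes\mathbf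 C)\to D\rtimes\mathbf C$ given by the additions of the groups $D_f$. 2. A quasi-inverse of $\Xi$ sends a Beck module $p$, naturally in $p$, to (a natural system isomorphic to) the natural system $D(p)$ with $D(p)_f=p^{-1}(f)$, with the above addition, and with $D(p)(a,b)(t)=0_b\circ t\circ 0_a$. -/

import Mathlib

open CategoryTheory Limits

universe u v w

/-! ### Small categories with a fixed set of objects -/

/-- A category with object set `O`; an object of `Cat_O` (homs in `Type v`). -/
structure CatOn (O : Type u) where
  Hom : O → O → Type v
  id : ∀ X, Hom X X
  comp : ∀ {X Y Z}, Hom X Y → Hom Y Z → Hom X Z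
  id_comp : ∀ {X Y} (f : Hom X Y), comp (id X) f = f
  comp_id : ∀ {X Y} (f : Hom X Y), comp f (id Y) = f
  assoc : ∀ {W X Y Z} (f : Hom W X) (g : Hom X Y) (h : Hom Y Z),
    comp (comp f g) h = comp f (comp g h)

/-- The type of objects of `A : CatOn O`, as a type on which the category structure lives. -/
def CatOn.Ob {O : Type u} (_ : CatOn.{u, v} O) : Type u := O

instance {O : Type u} (A : CatOn.{u, v} O) : Category.{v} A.Ob where
  Hom := A.Hom
  id := A.id
  comp := A.comp
  id_comp := A.id_comp
  comp_id := A.comp_id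
  assoc := A.assoc

/-- A functor that is the identity on objects. -/
@[ext]
structure IdFunctor {O : Type u} (A : CatOn.{u, v} O) (B : CatOn.{u, w} O) where
  map : ∀ {X Y : O}, A.Hom X Y → B.Hom X Y
  map_id : ∀ X, map (A.id X) = B.id X
  map_comp : ∀ {X Y Z} (f : A.Hom X Y) (g : A.Hom Y Z),
    map (A.comp f g) = B.comp (map f) (map g)

namespace IdFunctor

variable {O : Type u}

/-- The underlying functor. -/
def toFunctor {A : CatOn.{u, v} O} {B : CatOn.{u, w} O} (F : IdFunctor A B) : A.Ob ⥤ B.Ob where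
  obj X := X
  map f := F.map f
  map_id := F.map_id
  map_comp f g := F.map_comp f g

/-- The identity functor. -/
def refl (A : CatOn.{u, v} O) : IdFunctor A A where
  map f := f
  map_id _ := rfl
  map_comp _ _ := rfl

/-- `F.trans G` is `F` followed by `G`. -/
def trans {A B C : CatOn.{u, v} O} (F : IdFunctor A B) (G : IdFunctor B C) : IdFunctor A C where
  map f := G.map (F.map f)
  map_id X := by rw [F.map_id, G.map_id]
  map_comp f g := by rw [F.map_comp, G.map_comp]

end IdFunctor

/-- The category `Cat_O`. -/
instance (O : Type u) : Category (CatOn.{u, v} O) where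
  Hom := IdFunctor
  id := IdFunctor.refl
  comp := IdFunctor.trans

/-! ### Cartesian closed categories and cartesian closed functors -/

section CCC

variable {C : Type u} [Category.{v} C]

/-- `(p, q)` exhibits `P` as a product of `X` and `Y`. -/
def IsProd {P X Y : C} (p : P ⟶ X) (q : P ⟶ Y) : Prop :=
  Nonempty (IsLimit (BinaryFan.mk p q))

/-- `E` together with `e : P ⟶ Z`, where `P` is a product of `E` and `Y` via `(p, q)`,
is an exponential `Z ^ Y`: for each product `Q` of `X` and `Y` and each `f : Q ⟶ Z` there is
a unique `g : X ⟶ E` with `e ∘ (g × 1) = f`. -/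
structure IsExponential {P E Y Z : C} (p : P ⟶ E) (q : P ⟶ Y) (e : P ⟶ Z) : Prop where
  isProd : IsProd p q
  existsUnique : ∀ {Q X : C} (r : Q ⟶ X) (s : Q ⟶ Y), IsProd r s → ∀ f : Q ⟶ Z,
    ∃! g : X ⟶ E, ∃ h : Q ⟶ P, h ≫ p = r ≫ g ∧ h ≫ q = s ∧ h ≫ e = f

variable (C) in
/-- `C` is a cartesian closed category. -/
structure IsCCC : Prop where
  terminal : ∃ T : C, Nonempty (IsTerminal T)
  prod : ∀ X Y : C, ∃ (P : C) (p : P ⟶ X) (q : P ⟶ Y), IsProd p q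
  exp : ∀ Y Z : C, ∃ (P E : C) (p : P ⟶ E) (q : P ⟶ Y) (e : P ⟶ Z), IsExponential p q e

/-- A cartesian closed functor: it preserves finite products and exponentials. -/
structure IsCartesianClosedFunctor {D : Type u} [Category.{w} D] (F : C ⥤ D) : Prop where
  preservesFiniteProducts : PreservesFiniteProducts F
  map_isExponential : ∀ {P E Y Z : C} (p : P ⟶ E) (q : P ⟶ Y) (e : P ⟶ Z),
    IsExponential p q e → IsExponential (F.map p) (F.map q) (F.map e)

theorem isProd_iff {P X Y : C} (p : P ⟶ X) (q : P ⟶ Y) :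
    IsProd p q ↔ ∀ (W : C) (f : W ⟶ X) (g : W ⟶ Y), ∃! h : W ⟶ P, h ≫ p = f ∧ h ≫ q = g := by
  constructor
  · rintro ⟨hl⟩ W f g
    obtain ⟨l, h1, h2⟩ := BinaryFan.IsLimit.lift' hl f g
    refine ⟨l, ⟨h1, h2⟩, ?_⟩
    rintro m ⟨m1, m2⟩
    exact BinaryFan.IsLimit.hom_ext hl (m1.trans h1.symm) (m2.trans h2.symm)
  · intro h
    choose l hl hu using h
    exact ⟨BinaryFan.IsLimit.mk _ (fun f g => l _ f g) (fun f g => (hl _ f g).1)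
      (fun f g => (hl _ f g).2) (fun f g m h1 h2 => hu _ f g m ⟨h1, h2⟩)⟩

theorem IsProd.of_iso {P P' X Y : C} {p : P ⟶ X} {q : P ⟶ Y} (h : IsProd p q) (i : P' ≅ P)
    {p' : P' ⟶ X} {q' : P' ⟶ Y} (hp : i.hom ≫ p = p') (hq : i.hom ≫ q = q') : IsProd p' q' := by
  subst hp hq
  rw [isProd_iff] at h ⊢
  intro W f g
  obtain ⟨l, ⟨h1, h2⟩, hu⟩ := h W f g
  refine ⟨l ≫ i.inv, by simp [h1, h2], ?_⟩
  rintro m ⟨m1, m2⟩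
  rw [← hu (m ≫ i.hom) ⟨by simpa using m1, by simpa using m2⟩]
  simp

theorem IsProd.hom_ext {P X Y W : C} {p : P ⟶ X} {q : P ⟶ Y} (h : IsProd p q) {f g : W ⟶ P}
    (h1 : f ≫ p = g ≫ p) (h2 : f ≫ q = g ≫ q) : f = g :=
  BinaryFan.IsLimit.hom_ext h.some h1 h2

theorem IsProd.exists_lift {P X Y W : C} {p : P ⟶ X} {q : P ⟶ Y} (h : IsProd p q)
    (f : W ⟶ X) (g : W ⟶ Y) : ∃ l : W ⟶ P, l ≫ p = f ∧ l ≫ q = g :=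
  ((isProd_iff p q).1 h W f g).exists

theorem IsProd.exists_iso {P P' X Y : C} {p : P ⟶ X} {q : P ⟶ Y} {p' : P' ⟶ X} {q' : P' ⟶ Y}
    (h : IsProd p q) (h' : IsProd p' q') :
    ∃ i : P' ≅ P, i.hom ≫ p = p' ∧ i.hom ≫ q = q' := by
  obtain ⟨a, a1, a2⟩ := h.exists_lift p' q'
  obtain ⟨b, b1, b2⟩ := h'.exists_lift p q
  exact ⟨⟨a, b, h'.hom_ext (by simp [a1, b1]) (by simp [a2, b2]),
    h.hom_ext (by simp [a1, b1]) (by simp [a2, b2])⟩, a1, a2⟩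

/-- It is enough to test the universal property of an exponential on one product for each `X`. -/
theorem IsExponential.mk_of {P E Y Z : C} {p : P ⟶ E} {q : P ⟶ Y} {e : P ⟶ Z} (hp : IsProd p q)
    (H : ∀ X : C, ∃ (Q : C) (r : Q ⟶ X) (s : Q ⟶ Y), IsProd r s ∧ ∀ f : Q ⟶ Z,
      ∃! g : X ⟶ E, ∃ h : Q ⟶ P, h ≫ p = r ≫ g ∧ h ≫ q = s ∧ h ≫ e = f) :
    IsExponential p q e := by
  refine ⟨hp, ?_⟩
  intro Q' X r' s' h' f
  obtain ⟨Q, r, s, h, hu⟩ := H X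
  obtain ⟨i, i1, i2⟩ := h.exists_iso h'
  obtain ⟨g, ⟨k, k1, k2, k3⟩, gu⟩ := hu (i.inv ≫ f)
  refine ⟨g, ⟨i.hom ≫ k, by simp [k1, ← i1], by simp [k2, i2], by simp [k3]⟩, ?_⟩
  rintro g' ⟨k', k1', k2', k3'⟩
  exact gu g' ⟨i.inv ≫ k', by simp [k1', ← i1], by simp [k2', ← i2], by simp [k3']⟩

theorem IsExponential.of_iso {P E Y Z P' E' : C} {p : P ⟶ E} {q : P ⟶ Y} {e : P ⟶ Z}
    (h : IsExponential p q e) {p' : P' ⟶ E'} {q' : P' ⟶ Y} {e' : P' ⟶ Z}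
    (i : P' ≅ P) (j : E' ≅ E) (hp : i.hom ≫ p = p' ≫ j.hom) (hq : i.hom ≫ q = q')
    (he : i.hom ≫ e = e') : IsExponential p' q' e' := by
  have hp' : p' = i.hom ≫ p ≫ j.inv := by rw [← Category.assoc, hp]; simp
  subst hq he hp'
  refine ⟨?_, ?_⟩
  · rw [isProd_iff]
    intro W f g
    obtain ⟨l, ⟨h1, h2⟩, hu⟩ := (isProd_iff p q).1 h.isProd W (f ≫ j.hom) g
    refine ⟨l ≫ i.inv, ⟨?_, by simp [h2]⟩, ?_⟩
    · simp [reassoc_of% h1]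
    · rintro m ⟨m1, m2⟩
      rw [← hu (m ≫ i.hom) ⟨by simp [← m1], by simpa using m2⟩]
      simp
  · intro Q X r s hrs f
    obtain ⟨g, ⟨k, k1, k2, k3⟩, gu⟩ := h.existsUnique r s hrs f
    refine ⟨g ≫ j.inv, ⟨k ≫ i.inv, by simp [reassoc_of% k1], by simp [k2], by simp [k3]⟩, ?_⟩
    rintro g' ⟨k', k1', k2', k3'⟩
    rw [← gu (g' ≫ j.hom) ⟨k' ≫ i.hom, by simp [← reassoc_of% k1'], by simpa using k2',
      by simpa using k3'⟩]
    simp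

theorem IsExponential.exists_iso {P E Y Z P' E' : C} {p : P ⟶ E} {q : P ⟶ Y} {e : P ⟶ Z}
    {p' : P' ⟶ E'} {q' : P' ⟶ Y} {e' : P' ⟶ Z}
    (h : IsExponential p q e) (h' : IsExponential p' q' e') :
    ∃ (i : P' ≅ P) (j : E' ≅ E), i.hom ≫ p = p' ≫ j.hom ∧ i.hom ≫ q = q' ∧ i.hom ≫ e = e' := by
  obtain ⟨a, ⟨k, k1, k2, k3⟩, -⟩ := h.existsUnique p' q' h'.isProd e'
  obtain ⟨b, ⟨l, l1, l2, l3⟩, -⟩ := h'.existsUnique p q h.isProd e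
  have hab : a ≫ b = 𝟙 _ := (h'.existsUnique p' q' h'.isProd e').unique
    ⟨k ≫ l, by simp [l1, reassoc_of% k1], by simp [l2, k2], by simp [l3, k3]⟩ ⟨𝟙 _, by simp⟩
  have hba : b ≫ a = 𝟙 _ := (h.existsUnique p q h.isProd e).unique
    ⟨l ≫ k, by simp [k1, reassoc_of% l1], by simp [l2, k2], by simp [l3, k3]⟩ ⟨𝟙 _, by simp⟩
  refine ⟨⟨k, l, ?_, ?_⟩, ⟨a, b, hab, hba⟩, k1, k2, k3⟩
  · exact h'.isProd.hom_ext (by simp [l1, reassoc_of% k1, hab]) (by simp [l2, k2])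
  · exact h.isProd.hom_ext (by simp [k1, reassoc_of% l1, hba]) (by simp [l2, k2])

/-- A functor is cartesian closed as soon as it preserves one terminal object, one product of each
pair of objects and one exponential of each pair of objects. -/
theorem IsCartesianClosedFunctor.mk_of {D : Type u} [Category.{w} D] (F : C ⥤ D)
    (h1 : ∃ T : C, Nonempty (IsTerminal T) ∧ Nonempty (IsTerminal (F.obj T)))
    (h2 : ∀ X Y : C, ∃ (P : C) (p : P ⟶ X) (q : P ⟶ Y), IsProd p q ∧ IsProd (F.map p) (F.map q))
    (h3 : ∀ Y Z : C, ∃ (P E : C) (p : P ⟶ E) (q : P ⟶ Y) (e : P ⟶ Z),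
      IsExponential p q e ∧ IsExponential (F.map p) (F.map q) (F.map e)) :
    IsCartesianClosedFunctor F := by
  refine ⟨?_, ?_⟩
  · obtain ⟨T, ⟨hT⟩, ⟨hFT⟩⟩ := h1
    have : HasTerminal C := hT.hasTerminal
    have : HasBinaryProducts C := by
      have : ∀ X Y : C, HasLimit (pair X Y) := fun X Y => by
        obtain ⟨P, p, q, ⟨h⟩, -⟩ := h2 X Y
        exact ⟨⟨_, h⟩⟩
      exact hasBinaryProducts_of_hasLimit_pair C
    have : HasFiniteProducts C := hasFiniteProducts_of_has_binary_and_terminal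
    have : PreservesLimitsOfShape (Discrete WalkingPair) F := by
      refine ⟨fun {K} => ?_⟩
      obtain ⟨P, p, q, ⟨h⟩, ⟨h'⟩⟩ := h2 (K.obj ⟨.left⟩) (K.obj ⟨.right⟩)
      have : PreservesLimit (pair (K.obj ⟨.left⟩) (K.obj ⟨.right⟩)) F :=
        preservesLimit_of_preserves_limit_cone h ((isLimitMapConeBinaryFanEquiv F p q).symm h')
      exact preservesLimit_of_iso_diagram F (diagramIsoPair K).symm
    have : PreservesLimitsOfShape (Discrete PEmpty.{1}) F := by
      have : PreservesLimit (Functor.empty.{0} C) F :=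
        preservesLimit_of_preserves_limit_cone hT
          ((isLimitMapConeEmptyConeEquiv F T).symm hFT)
      exact preservesLimitsOfShape_pempty_of_preservesTerminal F
    exact PreservesFiniteProducts.of_preserves_binary_and_terminal F
  · intro P E Y Z p q e h
    obtain ⟨P', E', p', q', e', h', hF⟩ := h3 Y Z
    obtain ⟨i, j, hp, hq, he⟩ := h'.exists_iso h
    exact hF.of_iso (F.mapIso i) (F.mapIso j)
      ((F.map_comp _ _).symm.trans ((congrArg F.map hp).trans (F.map_comp _ _)))
      ((F.map_comp _ _).symm.trans (congrArg F.map hq))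
      ((F.map_comp _ _).symm.trans (congrArg F.map he))

theorem IsCartesianClosedFunctor.map_isProd {D : Type u} [Category.{w} D] {F : C ⥤ D}
    (hF : IsCartesianClosedFunctor F) {P X Y : C} {p : P ⟶ X} {q : P ⟶ Y} (h : IsProd p q) :
    IsProd (F.map p) (F.map q) := by
  have := hF.preservesFiniteProducts
  exact ⟨mapIsLimitOfPreservesOfIsLimit F p q h.some⟩

theorem IsCartesianClosedFunctor.map_isTerminal {D : Type u} [Category.{w} D] {F : C ⥤ D}
    (hF : IsCartesianClosedFunctor F) {T : C} (h : Nonempty (IsTerminal T)) :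
    Nonempty (IsTerminal (F.obj T)) := by
  have := hF.preservesFiniteProducts
  exact ⟨IsTerminal.isTerminalObj F T h.some⟩

end CCC

/-! ### Sorted cartesian closed categories -/

/-- The free pointed bi-magma generated by `S`; `exp Y Z` is the formal expression `Z ^ Y`. -/
inductive BiMag (S : Type u) : Type u
  | of : S → BiMag S
  | one : BiMag S
  | prod : BiMag S → BiMag S → BiMag S
  | exp : BiMag S → BiMag S → BiMag S

namespace FreeCCC

variable {S : Type u} (G : BiMag S → BiMag S → Type w)

/-- Formal morphisms generated by `G`. -/
inductive Term : BiMag S → BiMag S → Type (max u w)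
  | gen {X Y} : G X Y → Term X Y
  | id (X) : Term X X
  | bang (X) : Term X .one
  | fst (X Y) : Term (.prod X Y) X
  | snd (X Y) : Term (.prod X Y) Y
  | ev (Y Z) : Term (.prod (.exp Y Z) Y) Z
  | comp {X Y Z} : Term X Y → Term Y Z → Term X Z
  | pair {W X Y} : Term W X → Term W Y → Term W (.prod X Y)
  | curry {X Y Z} : Term (.prod X Y) Z → Term X (.exp Y Z)

variable {G} in
/-- The formal morphism `f × 1`. -/
def Term.prodId {X X'} (f : Term G X X') (Y : BiMag S) : Term G (.prod X Y) (.prod X' Y) :=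
  .pair (.comp (.fst X Y) f) (.comp (.snd X Y) (.id Y))

/-- The congruence on formal morphisms generated by the laws of cartesian closed categories. -/
inductive Rel : ∀ {X Y : BiMag S}, Term G X Y → Term G X Y → Prop
  | refl {X Y} (f : Term G X Y) : Rel f f
  | symm {X Y} {f g : Term G X Y} : Rel f g → Rel g f
  | trans {X Y} {f g h : Term G X Y} : Rel f g → Rel g h → Rel f h
  | congr_comp {X Y Z} {f f' : Term G X Y} {g g' : Term G Y Z} :
      Rel f f' → Rel g g' → Rel (.comp f g) (.comp f' g')
  | congr_pair {W X Y} {f f' : Term G W X} {g g' : Term G W Y} :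
      Rel f f' → Rel g g' → Rel (.pair f g) (.pair f' g')
  | congr_curry {X Y Z} {f f' : Term G (.prod X Y) Z} : Rel f f' → Rel (.curry f) (.curry f')
  | id_comp {X Y} (f : Term G X Y) : Rel (.comp (.id X) f) f
  | comp_id {X Y} (f : Term G X Y) : Rel (.comp f (.id Y)) f
  | assoc {W X Y Z} (f : Term G W X) (g : Term G X Y) (h : Term G Y Z) :
      Rel (.comp (.comp f g) h) (.comp f (.comp g h))
  | pair_fst {W X Y} (f : Term G W X) (g : Term G W Y) : Rel (.comp (.pair f g) (.fst X Y)) f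
  | pair_snd {W X Y} (f : Term G W X) (g : Term G W Y) : Rel (.comp (.pair f g) (.snd X Y)) g
  | pair_eta (X Y) : Rel (.pair (.fst X Y) (.snd X Y)) (.id (.prod X Y))
  | comp_pair {V W X Y} (k : Term G V W) (f : Term G W X) (g : Term G W Y) :
      Rel (.comp k (.pair f g)) (.pair (.comp k f) (.comp k g))
  | comp_bang {W X} (g : Term G W X) : Rel (.comp g (.bang X)) (.bang W)
  | bang_one : Rel (.bang .one) (.id .one)
  | beta {X Y Z} (f : Term G (.prod X Y) Z) :
      Rel (.comp (Term.prodId (.curry f) Y) (.ev Y Z)) f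
  | eta {X Y Z} (g : Term G X (.exp Y Z)) : Rel (.curry (.comp (Term.prodId g Y) (.ev Y Z))) g

/-- Equality of formal morphisms modulo the laws. -/
def setoid (X Y : BiMag S) : Setoid (Term G X Y) :=
  ⟨Rel G, ⟨.refl, .symm, .trans⟩⟩

end FreeCCC

/-- The free `S`-sorted cartesian closed category generated by `G`, as a category. -/
def freeCCC {S : Type u} (G : BiMag S → BiMag S → Type w) : CatOn.{u, max u w} (BiMag S) where
  Hom X Y := Quotient (FreeCCC.setoid G X Y)
  id X := Quotient.mk _ (.id X)
  comp := Quotient.map₂ .comp fun _ _ h _ _ h' => .congr_comp h h'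
  id_comp := by rintro X Y ⟨f⟩; exact Quotient.sound (.id_comp f)
  comp_id := by rintro X Y ⟨f⟩; exact Quotient.sound (.comp_id f)
  assoc := by rintro W X Y Z ⟨f⟩ ⟨g⟩ ⟨h⟩; exact Quotient.sound (.assoc f g h)

/-- `CFam_S`, the free `S`-sorted cartesian closed category on no generators. -/
def CFam (S : Type u) : CatOn.{u, u} (BiMag S) :=
  freeCCC fun _ _ => PEmpty.{u + 1}

namespace CFam

variable {S : Type u}

/-- The projection `X × Y ⟶ X`. -/
def fst (X Y : BiMag S) : (CFam S).Hom (.prod X Y) X := Quotient.mk _ (.fst X Y)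

/-- The projection `X × Y ⟶ Y`. -/
def snd (X Y : BiMag S) : (CFam S).Hom (.prod X Y) Y := Quotient.mk _ (.snd X Y)

/-- The evaluation map `Z ^ Y × Y ⟶ Z`. -/
def ev (Y Z : BiMag S) : (CFam S).Hom (.prod (.exp Y Z) Y) Z := Quotient.mk _ (.ev Y Z)

theorem isTerminal : Nonempty (IsTerminal (C := (CFam S).Ob) (BiMag.one : BiMag S)) := by
  refine ⟨IsTerminal.ofUniqueHom (fun X => Quotient.mk _ (.bang X)) ?_⟩
  rintro X ⟨f⟩
  exact Quotient.sound (.trans (.symm (.comp_id f))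
    (.trans (.congr_comp (.refl f) (.symm .bang_one)) (.comp_bang f)))

theorem isProd (X Y : BiMag S) :
    IsProd (C := (CFam S).Ob) (fst X Y) (snd X Y) := by
  refine (isProd_iff _ _).2 ?_
  rintro W ⟨f⟩ ⟨g⟩
  refine ⟨Quotient.mk _ (.pair f g), ⟨Quotient.sound (.pair_fst f g),
    Quotient.sound (.pair_snd f g)⟩, ?_⟩
  rintro ⟨m⟩ ⟨h1, h2⟩
  exact Quotient.sound (.trans (.symm (.comp_id m)) (.trans (.congr_comp (.refl m)
    (.symm (.pair_eta X Y))) (.trans (.comp_pair _ _ _)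
      (.congr_pair (Quotient.exact h1) (Quotient.exact h2)))))

theorem isExponential (Y Z : BiMag S) :
    IsExponential (C := (CFam S).Ob) (fst (.exp Y Z) Y) (snd (.exp Y Z) Y) (ev Y Z) := by
  refine IsExponential.mk_of (isProd _ _) fun X => ⟨_, _, _, isProd X Y, ?_⟩
  rintro ⟨f⟩
  refine ⟨Quotient.mk _ (.curry f), ⟨Quotient.mk _ (FreeCCC.Term.prodId (.curry f) Y),
    Quotient.sound (.pair_fst _ _), Quotient.sound (.trans (.pair_snd _ _) (.comp_id _)),
    Quotient.sound (.beta f)⟩, ?_⟩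
  rintro ⟨g⟩ ⟨⟨h⟩, h1, h2, h3⟩
  refine Quotient.sound (.trans (.symm (.eta g)) (.congr_curry ?_))
  refine .trans (.congr_comp ?_ (.refl _)) (Quotient.exact h3)
  refine .symm (.trans (.symm (.comp_id h)) (.trans (.congr_comp (.refl h)
    (.symm (.pair_eta _ Y))) (.trans (.comp_pair _ _ _)
      (.congr_pair (Quotient.exact h1) (.trans (Quotient.exact h2) (.symm (.comp_id _)))))))

theorem isCCC : IsCCC (CFam S).Ob where
  terminal := ⟨_, isTerminal⟩
  prod X Y := ⟨_, _, _, isProd X Y⟩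
  exp Y Z := ⟨_, _, _, _, _, isExponential Y Z⟩

end CFam

/-- An `S`-sorted cartesian closed category: a cartesian closed category with object set `BiMag S`
and a cartesian closed functor `ι` from `CFam S` that is the identity on objects. -/
structure SortedCCC (S : Type u) extends CatOn.{u, v} (BiMag S) where
  isCCC : IsCCC toCatOn.Ob
  ι : IdFunctor (CFam S) toCatOn
  ι_closed : IsCartesianClosedFunctor ι.toFunctor

namespace SortedCCC

variable {S : Type u}

/-- A morphism of `S`-sorted cartesian closed categories: a cartesian closed functor `F` with
`F ∘ ι = ι'` (in particular `F` is the identity on objects). -/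
@[ext]
structure Mor (A : SortedCCC.{u, v} S) (B : SortedCCC.{u, v} S) where
  functor : IdFunctor A.toCatOn B.toCatOn
  closed : IsCartesianClosedFunctor functor.toFunctor
  map_ι : ∀ {X Y : BiMag S} (f : (CFam S).Hom X Y), functor.map (A.ι.map f) = B.ι.map f

section

variable (A : SortedCCC.{u, v} S)

/-- The specified projection `X × Y ⟶ X`. -/
def fst (X Y : BiMag S) : A.Hom (.prod X Y) X := A.ι.map (CFam.fst X Y)

/-- The specified projection `X × Y ⟶ Y`. -/
def snd (X Y : BiMag S) : A.Hom (.prod X Y) Y := A.ι.map (CFam.snd X Y)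

/-- The specified evaluation map `Z ^ Y × Y ⟶ Z`. -/
def ev (Y Z : BiMag S) : A.Hom (.prod (.exp Y Z) Y) Z := A.ι.map (CFam.ev Y Z)

theorem isTerminal : Nonempty (IsTerminal (C := A.Ob) (BiMag.one : BiMag S)) :=
  A.ι_closed.map_isTerminal CFam.isTerminal

theorem isProd (X Y : BiMag S) : IsProd (C := A.Ob) (A.fst X Y) (A.snd X Y) :=
  A.ι_closed.map_isProd (CFam.isProd X Y)

theorem isExponential (Y Z : BiMag S) :
    IsExponential (C := A.Ob) (A.fst (.exp Y Z) Y) (A.snd (.exp Y Z) Y) (A.ev Y Z) :=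
  A.ι_closed.map_isExponential _ _ _ (CFam.isExponential Y Z)

variable {A}

theorem existsUnique_lift {W X Y : BiMag S} (f : A.Hom W X) (g : A.Hom W Y) :
    ∃! l : A.Hom W (.prod X Y), A.comp l (A.fst X Y) = f ∧ A.comp l (A.snd X Y) = g :=
  (isProd_iff _ _).1 (A.isProd X Y) W f g

/-- The morphism `⟨f, g⟩ : W ⟶ X × Y`. -/
noncomputable def lift {W X Y : BiMag S} (f : A.Hom W X) (g : A.Hom W Y) :
    A.Hom W (.prod X Y) :=
  (existsUnique_lift f g).choose

theorem lift_fst {W X Y : BiMag S} (f : A.Hom W X) (g : A.Hom W Y) :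
    A.comp (lift f g) (A.fst X Y) = f :=
  (existsUnique_lift f g).choose_spec.1.1

theorem lift_snd {W X Y : BiMag S} (f : A.Hom W X) (g : A.Hom W Y) :
    A.comp (lift f g) (A.snd X Y) = g :=
  (existsUnique_lift f g).choose_spec.1.2

theorem prod_hom_ext {W X Y : BiMag S} {k l : A.Hom W (.prod X Y)}
    (h1 : A.comp k (A.fst X Y) = A.comp l (A.fst X Y))
    (h2 : A.comp k (A.snd X Y) = A.comp l (A.snd X Y)) : k = l :=
  (existsUnique_lift _ _).unique ⟨h1, h2⟩ ⟨rfl, rfl⟩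

/-- The morphism `g × 1 : X × Y ⟶ W × Y`. -/
noncomputable def prodId {X W : BiMag S} (g : A.Hom X W) (Y : BiMag S) :
    A.Hom (.prod X Y) (.prod W Y) :=
  lift (A.comp (A.fst X Y) g) (A.snd X Y)

theorem existsUnique_curry {X Y Z : BiMag S} (f : A.Hom (.prod X Y) Z) :
    ∃! g : A.Hom X (.exp Y Z), A.comp (prodId g Y) (A.ev Y Z) = f := by
  obtain ⟨g, ⟨h, h1, h2, h3⟩, hu⟩ := (A.isExponential Y Z).existsUnique _ _ (A.isProd X Y) f
  refine ⟨g, ?_, fun g' hg' => hu g' ⟨prodId g' Y, lift_fst _ _, lift_snd _ _, hg'⟩⟩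
  have : h = prodId g Y := prod_hom_ext (h1.trans (lift_fst _ _).symm)
    (h2.trans (lift_snd _ _).symm)
  exact (congrArg (A.comp · (A.ev Y Z)) this).symm.trans h3

/-- The transpose `λ f : X ⟶ Z ^ Y` of `f : X × Y ⟶ Z`. -/
noncomputable def curry {X Y Z : BiMag S} (f : A.Hom (.prod X Y) Z) : A.Hom X (.exp Y Z) :=
  (existsUnique_curry f).choose

theorem curry_ev {X Y Z : BiMag S} (f : A.Hom (.prod X Y) Z) :
    A.comp (prodId (curry f) Y) (A.ev Y Z) = f :=
  (existsUnique_curry f).choose_spec.1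

theorem exp_hom_ext {X Y Z : BiMag S} {g h : A.Hom X (.exp Y Z)}
    (e : A.comp (prodId g Y) (A.ev Y Z) = A.comp (prodId h Y) (A.ev Y Z)) : g = h :=
  (existsUnique_curry _).unique e rfl

end

/-- A category under `CFam S` in which the specified diagrams are terminal objects, products and
exponentials is an `S`-sorted cartesian closed category. -/
def mk' (A : CatOn.{u, v} (BiMag S)) (ι : IdFunctor (CFam S) A)
    (h1 : Nonempty (IsTerminal (C := A.Ob) (BiMag.one : BiMag S)))
    (h2 : ∀ X Y, IsProd (C := A.Ob) (ι.map (CFam.fst X Y)) (ι.map (CFam.snd X Y)))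
    (h3 : ∀ Y Z, IsExponential (C := A.Ob) (ι.map (CFam.fst (.exp Y Z) Y))
      (ι.map (CFam.snd (.exp Y Z) Y)) (ι.map (CFam.ev Y Z))) : SortedCCC.{u, v} S where
  toCatOn := A
  isCCC := ⟨⟨_, h1⟩, fun X Y => ⟨_, _, _, h2 X Y⟩, fun Y Z => ⟨_, _, _, _, _, h3 Y Z⟩⟩
  ι := ι
  ι_closed := .mk_of _ ⟨_, CFam.isTerminal, h1⟩ (fun X Y => ⟨_, _, _, CFam.isProd X Y, h2 X Y⟩)
    (fun Y Z => ⟨_, _, _, _, _, CFam.isExponential Y Z, h3 Y Z⟩)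

/-- A functor under `CFam S` is automatically cartesian closed. -/
def Mor.mk' {A B : SortedCCC.{u, v} S} (F : IdFunctor A.toCatOn B.toCatOn)
    (h : ∀ {X Y : BiMag S} (f : (CFam S).Hom X Y), F.map (A.ι.map f) = B.ι.map f) :
    Mor A B where
  functor := F
  closed := by
    refine .mk_of _ ⟨_, A.isTerminal, B.isTerminal⟩
      (fun X Y => ⟨_, _, _, A.isProd X Y, ?_⟩)
      (fun Y Z => ⟨_, _, _, _, _, A.isExponential Y Z, ?_⟩)
    · exact (congrArg₂ (IsProd (C := B.Ob)) (h (CFam.fst X Y)) (h (CFam.snd X Y))).mpr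
        (B.isProd X Y)
    · have e1 := h (CFam.fst (.exp Y Z) Y)
      have e2 := h (CFam.snd (.exp Y Z) Y)
      have e3 := h (CFam.ev Y Z)
      have key : ∀ p q e, p = B.fst (.exp Y Z) Y → q = B.snd (.exp Y Z) Y → e = B.ev Y Z →
          IsExponential (C := B.Ob) p q e := by
        rintro _ _ _ rfl rfl rfl
        exact B.isExponential Y Z
      exact key _ _ _ e1 e2 e3
  map_ι := h

/-- The category `CCC_S`. -/
instance : Category (SortedCCC.{u, v} S) where
  Hom := Mor
  id A := .mk' (.refl _) fun _ => rfl
  comp F G := .mk' (F.functor.trans G.functor) fun f =>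
    (congrArg G.functor.map (F.map_ι f)).trans (G.map_ι f)

@[ext]
theorem hom_ext {A B : SortedCCC.{u, v} S} {F G : A ⟶ B}
    (h : ∀ (X Y : BiMag S) (f : A.Hom X Y), F.functor.map f = G.functor.map f) : F = G :=
  Mor.ext (IdFunctor.ext (by funext X Y f; exact h X Y f))

section

variable {A B : SortedCCC.{u, v} S} (F : A ⟶ B)

theorem map_fst (X Y : BiMag S) : F.functor.map (A.fst X Y) = B.fst X Y := F.map_ι _

theorem map_snd (X Y : BiMag S) : F.functor.map (A.snd X Y) = B.snd X Y := F.map_ι _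

theorem map_ev (Y Z : BiMag S) : F.functor.map (A.ev Y Z) = B.ev Y Z := F.map_ι _

theorem map_lift {W X Y : BiMag S} (f : A.Hom W X) (g : A.Hom W Y) :
    F.functor.map (lift f g) = lift (F.functor.map f) (F.functor.map g) := by
  apply prod_hom_ext
  · rw [← map_fst F, ← F.functor.map_comp, lift_fst, map_fst, lift_fst]
  · rw [← map_snd F, ← F.functor.map_comp, lift_snd, map_snd, lift_snd]

theorem map_prodId {X W : BiMag S} (g : A.Hom X W) (Y : BiMag S) :
    F.functor.map (prodId g Y) = prodId (F.functor.map g) Y := by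
  rw [prodId, map_lift, F.functor.map_comp, map_fst, map_snd, prodId]

theorem map_curry {X Y Z : BiMag S} (f : A.Hom (.prod X Y) Z) :
    F.functor.map (curry f) = curry (F.functor.map f) := by
  apply exp_hom_ext
  rw [curry_ev, ← map_prodId, ← map_ev F, ← F.functor.map_comp, curry_ev]

end

/-! ### Fibre products of sorted cartesian closed categories -/

section FibreProduct

variable {A B C : SortedCCC.{u, v} S} (F : A ⟶ C) (G : B ⟶ C)

/-- The fibre product of the underlying categories. -/
def fibreProductCat : CatOn.{u, v} (BiMag S) where
  Hom X Y := {f : A.Hom X Y × B.Hom X Y // F.functor.map f.1 = G.functor.map f.2}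
  id X := ⟨(A.id X, B.id X), by rw [F.functor.map_id, G.functor.map_id]⟩
  comp f g := ⟨(A.comp f.1.1 g.1.1, B.comp f.1.2 g.1.2), by
    rw [F.functor.map_comp, G.functor.map_comp, f.2, g.2]⟩
  id_comp f := Subtype.ext (Prod.ext (A.id_comp _) (B.id_comp _))
  comp_id f := Subtype.ext (Prod.ext (A.comp_id _) (B.comp_id _))
  assoc f g h := Subtype.ext (Prod.ext (A.assoc _ _ _) (B.assoc _ _ _))

theorem fibreProduct_isTerminal :
    Nonempty (IsTerminal (C := (fibreProductCat F G).Ob) (BiMag.one : BiMag S)) := by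
  obtain ⟨tA⟩ := A.isTerminal
  obtain ⟨tB⟩ := B.isTerminal
  obtain ⟨tC⟩ := C.isTerminal
  exact ⟨IsTerminal.ofUniqueHom (fun X => ⟨(tA.from X, tB.from X), tC.hom_ext _ _⟩)
    fun X m => Subtype.ext (Prod.ext (tA.hom_ext _ _) (tB.hom_ext _ _))⟩

/-- The fibre product of the structure functors. -/
def fibreProductι : IdFunctor (CFam S) (fibreProductCat F G) where
  map f := ⟨(A.ι.map f, B.ι.map f), (F.map_ι f).trans (G.map_ι f).symm⟩
  map_id X := Subtype.ext (Prod.ext (A.ι.map_id X) (B.ι.map_id X))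
  map_comp f g := Subtype.ext (Prod.ext (A.ι.map_comp f g) (B.ι.map_comp f g))

theorem fibreProduct_isProd (X Y : BiMag S) :
    IsProd (C := (fibreProductCat F G).Ob) ((fibreProductι F G).map (CFam.fst X Y))
      ((fibreProductι F G).map (CFam.snd X Y)) := by
  refine (isProd_iff _ _).2 ?_
  rintro W ⟨⟨f, f'⟩, hf⟩ ⟨⟨g, g'⟩, hg⟩
  refine ⟨⟨(lift f g, lift f' g'), ?_⟩, ⟨Subtype.ext (Prod.ext (lift_fst f g) (lift_fst f' g')),
    Subtype.ext (Prod.ext (lift_snd f g) (lift_snd f' g'))⟩, ?_⟩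
  · exact (map_lift F f g).trans ((congrArg₂ lift hf hg).trans (map_lift G f' g').symm)
  rintro ⟨⟨m, m'⟩, hm⟩ ⟨h1, h2⟩
  have h1' := congrArg Subtype.val h1
  have h2' := congrArg Subtype.val h2
  exact Subtype.ext (Prod.ext
    (prod_hom_ext ((congrArg Prod.fst h1').trans (lift_fst f g).symm)
      ((congrArg Prod.fst h2').trans (lift_snd f g).symm))
    (prod_hom_ext ((congrArg Prod.snd h1').trans (lift_fst f' g').symm)
      ((congrArg Prod.snd h2').trans (lift_snd f' g').symm)))

theorem fibreProduct_isExponential (Y Z : BiMag S) :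
    IsExponential (C := (fibreProductCat F G).Ob)
      ((fibreProductι F G).map (CFam.fst (.exp Y Z) Y))
      ((fibreProductι F G).map (CFam.snd (.exp Y Z) Y))
      ((fibreProductι F G).map (CFam.ev Y Z)) := by
  refine IsExponential.mk_of (fibreProduct_isProd F G _ _) fun X =>
    ⟨_, _, _, fibreProduct_isProd F G X Y, ?_⟩
  rintro ⟨⟨f, f'⟩, hf⟩
  have key : F.functor.map (curry f) = G.functor.map (curry f') :=
    (map_curry F f).trans ((congrArg curry hf).trans (map_curry G f').symm)
  have key2 : F.functor.map (prodId (curry f) Y) = G.functor.map (prodId (curry f') Y) :=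
    (map_prodId F _ Y).trans ((congrArg (prodId · Y) key).trans (map_prodId G _ Y).symm)
  refine ⟨⟨(curry f, curry f'), key⟩, ⟨⟨(prodId (curry f) Y, prodId (curry f') Y), key2⟩,
    Subtype.ext (Prod.ext (lift_fst _ _) (lift_fst _ _)),
    Subtype.ext (Prod.ext (lift_snd _ _) (lift_snd _ _)),
    Subtype.ext (Prod.ext (curry_ev f) (curry_ev f'))⟩, ?_⟩
  rintro ⟨⟨m, m'⟩, hm⟩ ⟨⟨⟨n, n'⟩, hn⟩, h1, h2, h3⟩
  have h1' := congrArg Subtype.val h1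
  have h2' := congrArg Subtype.val h2
  have h3' := congrArg Subtype.val h3
  have en : n = prodId m Y := prod_hom_ext ((congrArg Prod.fst h1').trans (lift_fst _ _).symm)
    ((congrArg Prod.fst h2').trans (lift_snd _ _).symm)
  have en' : n' = prodId m' Y := prod_hom_ext ((congrArg Prod.snd h1').trans (lift_fst _ _).symm)
    ((congrArg Prod.snd h2').trans (lift_snd _ _).symm)
  subst en en'
  exact Subtype.ext (Prod.ext
    (exp_hom_ext ((congrArg Prod.fst h3').trans (curry_ev f).symm))
    (exp_hom_ext ((congrArg Prod.snd h3').trans (curry_ev f').symm)))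

/-- The fibre product of sorted cartesian closed categories: its morphisms `X ⟶ Y` are the pairs
of morphisms of `A` and `B` with the same image in `C`. -/
def fibreProduct : SortedCCC.{u, v} S :=
  .mk' (fibreProductCat F G) (fibreProductι F G) (fibreProduct_isTerminal F G)
    (fibreProduct_isProd F G) (fibreProduct_isExponential F G)

/-- The first projection. -/
def fibreProductFst : fibreProduct F G ⟶ A :=
  .mk' ⟨fun f => f.1.1, fun _ => rfl, fun _ _ => rfl⟩ fun _ => rfl

/-- The second projection. -/
def fibreProductSnd : fibreProduct F G ⟶ B :=
  .mk' ⟨fun f => f.1.2, fun _ => rfl, fun _ _ => rfl⟩ fun _ => rfl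

variable {F G} in
/-- The morphism to the fibre product with given components. -/
def fibreProductLift {T : SortedCCC.{u, v} S} (a : T ⟶ A) (b : T ⟶ B) (h : a ≫ F = b ≫ G) :
    T ⟶ fibreProduct F G :=
  .mk' ⟨fun f => ⟨(a.functor.map f, b.functor.map f),
      congrArg (fun t : T ⟶ C => t.functor.map f) h⟩,
    fun X => Subtype.ext (Prod.ext (a.functor.map_id X) (b.functor.map_id X)),
    fun f g => Subtype.ext (Prod.ext (a.functor.map_comp f g) (b.functor.map_comp f g))⟩
    fun f => Subtype.ext (Prod.ext (a.map_ι f) (b.map_ι f))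

end FibreProduct

/-- Finite products in `CCC_S / C`: the terminal object is the identity of `C`, binary products are
fibre products over `C`. -/
instance (C : SortedCCC.{u, v} S) : CartesianMonoidalCategory (Over C) :=
  .ofChosenFiniteProducts
    ⟨asEmptyCone (Over.mk (𝟙 C)), IsTerminal.ofUniqueHom (fun Y ↦ Over.homMk Y.hom)
      fun Y m ↦ Over.OverMorphism.ext (by simpa using m.w)⟩
    fun M N => ⟨BinaryFan.mk
      (P := Over.mk (fibreProductFst M.hom N.hom ≫ M.hom))
      (Over.homMk (fibreProductFst M.hom N.hom))
      (Over.homMk (fibreProductSnd M.hom N.hom) (hom_ext fun _ _ f => f.2.symm)),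
      BinaryFan.IsLimit.mk _
        (fun {T} a b => Over.homMk (fibreProductLift a.left b.left (by simp))
          (hom_ext fun _ _ f => congrArg (fun t : T.left ⟶ C => t.functor.map f) (Over.w a)))
        (fun a b => rfl) (fun a b => rfl)
        (fun {T} a b m h1 h2 => Over.OverMorphism.ext (hom_ext fun _ _ f => Subtype.ext (Prod.ext
          (congrArg (fun t : T ⟶ M => t.left.functor.map f) h1)
          (congrArg (fun t : T ⟶ N => t.left.functor.map f) h2))))⟩

noncomputable instance (C : SortedCCC.{u, v} S) : BraidedCategory (Over C) :=
  .ofCartesianMonoidalCategory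

end SortedCCC

/-! ### Natural systems -/

/-- Objects of the category of factorizations in `C`: the morphisms of `C`. -/
structure Factorization (C : Type u) [Category.{v} C] where
  {dom cod : C}
  arrow : dom ⟶ cod

namespace Factorization

variable {C : Type u} [Category.{v} C]

/-- A morphism `(a, b) : f ⟶ g` of factorizations: `b ∘ f ∘ a = g`. -/
@[ext]
structure Hom (f g : Factorization C) where
  left : g.dom ⟶ f.dom
  right : f.cod ⟶ g.cod
  w : left ≫ f.arrow ≫ right = g.arrow

instance : Category (Factorization C) where
  Hom := Hom
  id f := ⟨𝟙 _, 𝟙 _, by simp⟩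
  comp a b := ⟨b.left ≫ a.left, a.right ≫ b.right, by simp [← b.w, ← a.w]⟩
  id_comp a := Hom.ext (Category.comp_id _) (Category.id_comp _)
  comp_id a := Hom.ext (Category.id_comp _) (Category.comp_id _)
  assoc a b c := Hom.ext (Category.assoc _ _ _).symm (Category.assoc _ _ _)

end Factorization

/-- The category of natural systems on `C`. -/
abbrev NatSystem (C : Type u) [Category.{v} C] := Factorization C ⥤ AddCommGrpCat.{v}

namespace NatSystem

variable {C : Type u} [Category.{v} C]

/-- The group `D_f`. -/
abbrev grp (D : NatSystem C) {X Y : C} (f : X ⟶ Y) : AddCommGrpCat.{v} := D.obj ⟨f⟩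

/-- The map `a_* : D_f → D_g`, where `g = a ∘ f`. -/
def push (D : NatSystem C) {X Y Z : C} {f : X ⟶ Y} (a : Y ⟶ Z) {g : X ⟶ Z} (h : f ≫ a = g) :
    D.grp f →+ D.grp g :=
  (D.map (X := ⟨f⟩) (Y := ⟨g⟩) ⟨𝟙 X, a, by simpa using h⟩).hom

/-- The map `a^* : D_f → D_g`, where `g = f ∘ a`. -/
def pull (D : NatSystem C) {W X Y : C} {f : X ⟶ Y} (a : W ⟶ X) {g : W ⟶ Y} (h : a ≫ f = g) :
    D.grp f →+ D.grp g :=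
  (D.map (X := ⟨f⟩) (Y := ⟨g⟩) ⟨a, 𝟙 Y, by simpa using h⟩).hom

/-- `D` is cartesian: for each finite product `P` of objects `X j`, with projections `π j`, and
each `f : A ⟶ P`, the homomorphism `D_f → ∏ j, D_{π j ∘ f}` is an isomorphism. -/
def IsCartesian (D : NatSystem C) : Prop :=
  ∀ (J : Type) [Finite J] (X : J → C) (P : Fan X), Nonempty (IsLimit P) →
    ∀ (A : C) (f : A ⟶ P.pt),
      Function.Bijective fun (ξ : D.grp f) (j : J) => D.push (P.proj j) (g := f ≫ P.proj j) rfl ξ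

end NatSystem

namespace NatSystem

open SortedCCC

section Closed

variable {S : Type u} {A : SortedCCC.{u, v} S} {D : NatSystem A.Ob}

theorem IsCartesian.bijective_prod (hD : D.IsCartesian) {W X Y : BiMag S} (f : A.Hom W (.prod X Y))
    {g : A.Hom W X} {h : A.Hom W Y} (hg : A.comp f (A.fst X Y) = g)
    (hh : A.comp f (A.snd X Y) = h) :
    Function.Bijective
      ((D.push (A.fst X Y) hg).prod (D.push (A.snd X Y) hh) : D.grp f →+ D.grp g × D.grp h) := by
  subst hg hh
  have key := hD WalkingPair (fun j => @WalkingPair.casesOn (fun _ => A.Ob) j X Y)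
    (@BinaryFan.mk A.Ob _ X Y (BiMag.prod X Y) (A.fst X Y) (A.snd X Y)) (A.isProd X Y) W f
  constructor
  · intro a b hab
    refine key.1 (funext fun j => ?_)
    cases j
    · exact congrArg Prod.fst hab
    · exact congrArg Prod.snd hab
  · rintro ⟨a, b⟩
    obtain ⟨c, hc⟩ := key.2 fun j => match j with
      | .left => a
      | .right => b
    exact ⟨c, Prod.ext (congrFun hc .left) (congrFun hc .right)⟩

/-- For `g : X ⟶ W` and an object `Y`, the composite `φ_g` of `π₁^* × 1` with the inverse of the
isomorphism `D_{g × 1} → D_{g ∘ π₁} × D_{π₂}`. -/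
noncomputable def phi (hD : D.IsCartesian) {X W : BiMag S} (g : A.Hom X W) (Y : BiMag S) :
    D.grp g × D.grp (A.snd X Y) →+ D.grp (prodId g Y) :=
  (AddEquiv.ofBijective _ (hD.bijective_prod (prodId g Y) (lift_fst (A.comp (A.fst X Y) g) _)
    (lift_snd _ (A.snd X Y)))).symm.toAddMonoidHom.comp
    (AddMonoidHom.prodMap (D.pull (f := g) (A.fst X Y) rfl) (AddMonoidHom.id _))

/-- For `f : X × Y ⟶ Z`, the homomorphism `D_{λ f} → D_f`, `ξ ↦ ev_* (φ_{λ f} (ξ, 0))`. -/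
noncomputable def closedMap (hD : D.IsCartesian) {X Y Z : BiMag S} (f : A.Hom (.prod X Y) Z) :
    D.grp (curry f) →+ D.grp f :=
  (D.push (A.ev Y Z) (curry_ev f)).comp
    ((phi hD (curry f) Y).comp (AddMonoidHom.inl _ (D.grp (A.snd X Y))))

variable (D) in
/-- `D` is cartesian closed: it is cartesian and the maps `D_{λ f} → D_f` are isomorphisms. -/
structure IsCartesianClosed : Prop where
  isCartesian : D.IsCartesian
  bijective_closedMap : ∀ {X Y Z : BiMag S} (f : A.Hom (.prod X Y) Z),
    Function.Bijective (closedMap isCartesian f)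

end Closed

end NatSystem

/-- The category of cartesian closed natural systems on `C`, a full subcategory of the category of
natural systems. -/
abbrev CCNat {S : Type u} (C : SortedCCC.{u, v} S) :=
  ObjectProperty.FullSubcategory fun D : NatSystem C.Ob => D.IsCartesianClosed

/-! ### Trivial extensions -/

section TrivialExtension

variable {O : Type u} {C : CatOn.{u, v} O} (D : NatSystem C.Ob)

theorem NatSystem.push_id {C : Type u} [Category.{v} C] (D : NatSystem C) {X Y : C} {f : X ⟶ Y}
    (a : D.grp f) : D.push (f := f) (g := f) (𝟙 Y) (by simp) a = a :=
  congrArg (fun t : D.grp f ⟶ D.grp f => t.hom a) (D.map_id ⟨f⟩)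

section

variable {C : Type u} [Category.{v} C] (D : NatSystem C)

theorem NatSystem.push_push {X Y Z W : C} {f : X ⟶ Y} {g : X ⟶ Z} {h : X ⟶ W} (a : Y ⟶ Z)
    (b : Z ⟶ W) (ha : f ≫ a = g) (hb : g ≫ b = h) (x : D.grp f) :
    D.push b hb (D.push a ha x) = D.push (a ≫ b) (by rw [← hb, ← ha, Category.assoc]) x := by
  refine (congrArg (fun t : D.grp f ⟶ D.grp h => t.hom x) (D.map_comp (X := ⟨f⟩) (Y := ⟨g⟩)
    (Z := ⟨h⟩) ⟨𝟙 X, a, by simpa using ha⟩ ⟨𝟙 X, b, by simpa using hb⟩)).symm.trans ?_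
  have e : 𝟙 X ≫ 𝟙 X = 𝟙 X := by simp
  exact congrArg (fun t : D.grp f ⟶ D.grp h => t.hom x)
    (congrArg (D.map (X := ⟨f⟩) (Y := ⟨h⟩)) (Factorization.Hom.ext e rfl))

theorem NatSystem.pull_pull {X Y Z W : C} {f : X ⟶ Y} {g : Z ⟶ Y} {h : W ⟶ Y} (a : Z ⟶ X)
    (b : W ⟶ Z) (ha : a ≫ f = g) (hb : b ≫ g = h) (x : D.grp f) :
    D.pull b hb (D.pull a ha x) = D.pull (b ≫ a) (by rw [← hb, ← ha, Category.assoc]) x := by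
  refine (congrArg (fun t : D.grp f ⟶ D.grp h => t.hom x) (D.map_comp (X := ⟨f⟩) (Y := ⟨g⟩)
    (Z := ⟨h⟩) ⟨a, 𝟙 Y, by simpa using ha⟩ ⟨b, 𝟙 Y, by simpa using hb⟩)).symm.trans ?_
  have e : 𝟙 Y ≫ 𝟙 Y = 𝟙 Y := by simp
  exact congrArg (fun t : D.grp f ⟶ D.grp h => t.hom x)
    (congrArg (D.map (X := ⟨f⟩) (Y := ⟨h⟩)) (Factorization.Hom.ext rfl e))

theorem NatSystem.push_pull {X Y Z W : C} {f : X ⟶ Y} {g : Z ⟶ Y} {h : X ⟶ W} {k : Z ⟶ W}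
    (a : Z ⟶ X) (b : Y ⟶ W) (ha : a ≫ f = g) (hb : g ≫ b = k) (hb' : f ≫ b = h)
    (ha' : a ≫ h = k) (x : D.grp f) :
    D.push b hb (D.pull a ha x) = D.pull a ha' (D.push b hb' x) := by
  have e1 := congrArg (fun t : D.grp f ⟶ D.grp k => t.hom x) (D.map_comp (X := ⟨f⟩) (Y := ⟨g⟩)
    (Z := ⟨k⟩) ⟨a, 𝟙 Y, by simpa using ha⟩ ⟨𝟙 Z, b, by simpa using hb⟩)
  have e2 := congrArg (fun t : D.grp f ⟶ D.grp k => t.hom x) (D.map_comp (X := ⟨f⟩) (Y := ⟨h⟩)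
    (Z := ⟨k⟩) ⟨𝟙 X, b, by simpa using hb'⟩ ⟨a, 𝟙 W, by simpa using ha'⟩)
  have e3 : 𝟙 Z ≫ a = a ≫ 𝟙 X := by simp
  have e4 : 𝟙 Y ≫ b = b ≫ 𝟙 W := by simp
  exact (e1.symm.trans (congrArg (fun t : D.grp f ⟶ D.grp k => t.hom x)
    (congrArg (D.map (X := ⟨f⟩) (Y := ⟨k⟩)) (Factorization.Hom.ext e3 e4)))).trans e2

theorem NatSystem.pull_id {X Y : C} {f : X ⟶ Y} (a : D.grp f) :
    D.pull (f := f) (g := f) (𝟙 X) (by simp) a = a :=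
  congrArg (fun t : D.grp f ⟶ D.grp f => t.hom a) (D.map_id ⟨f⟩)

theorem NatSystem.trivial_id_comp {X Y : C} {f g : X ⟶ Y} (h : 𝟙 X ≫ f = g) (a : D.grp f)
    (e : g ≫ 𝟙 Y = f) :
    D.push (𝟙 Y) e (D.push f h 0 + D.pull (𝟙 X) h a) = a := by
  obtain rfl : f = g := by simpa using h
  rw [map_zero, zero_add, pull_id, push_id]

theorem NatSystem.trivial_comp_id {X Y : C} {f g : X ⟶ Y} (h : f ≫ 𝟙 Y = g) (a : D.grp f)
    (e : g ≫ 𝟙 Y = f) :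
    D.push (𝟙 Y) e (D.push (𝟙 Y) h a + D.pull f h 0) = a := by
  obtain rfl : f = g := by simpa using h
  rw [map_zero, add_zero, push_id, push_id]

theorem NatSystem.trivial_assoc {W X Y Z : C} (f : W ⟶ X) (g : X ⟶ Y) (h : Y ⟶ Z)
    (a : D.grp f) (b : D.grp g) (c : D.grp h) (e : ((f ≫ g) ≫ h) ≫ 𝟙 Z = f ≫ g ≫ h) :
    D.push (g := f ≫ g ≫ h) (𝟙 Z) e
      (D.push (g := (f ≫ g) ≫ h) h rfl (D.push (g := f ≫ g) g rfl a + D.pull f rfl b) +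
        D.pull (f ≫ g) rfl c) =
      D.push (g ≫ h) rfl a + D.pull f rfl (D.push (g := g ≫ h) h rfl b + D.pull g rfl c) := by
  simp only [map_add]
  rw [D.push_push h (𝟙 Z), D.push_push g _, D.push_push h (𝟙 Z),
    D.push_pull f (h ≫ 𝟙 Z) rfl _ (show g ≫ h ≫ 𝟙 Z = g ≫ h by simp) rfl,
    D.pull_pull g f, D.push_pull (f ≫ g) (𝟙 Z) rfl _ (show h ≫ 𝟙 Z = h by simp) (by simp),
    D.push_id, add_assoc]
  congr 1
  · congr 2; simp
  · congr 3; simp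

end

theorem NatSystem.sigma_ext {X Y : O} {f g : C.Hom X Y} (h : f = g) (a : D.grp f) (b : D.grp g)
    (hab : D.push (f := f) (g := g) (C.id Y) ((C.comp_id f).trans h) a = b) :
    (⟨f, a⟩ : Σ f : C.Hom X Y, D.grp f) = ⟨g, b⟩ := by
  subst h hab
  exact congrArg (Sigma.mk f) (D.push_id (C := C.Ob) (f := f) a).symm

/-- The trivial extension `D ⋊ C`: a morphism is a pair of a morphism `f` of `C` and an element of
`D_f`, and the composite of `η ∈ D_g` followed by `ξ ∈ D_f` is `f_* η + g^* ξ`. -/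
def trivialExtension : CatOn.{u, v} O where
  Hom X Y := Σ f : C.Hom X Y, D.grp f
  id X := ⟨C.id X, 0⟩
  comp t s := ⟨C.comp t.1 s.1, D.push s.1 rfl t.2 + D.pull t.1 rfl s.2⟩
  id_comp _ := D.sigma_ext (C.id_comp _) _ _ (D.trivial_id_comp (C := C.Ob) _ _ _)
  comp_id _ := D.sigma_ext (C.comp_id _) _ _ (D.trivial_comp_id (C := C.Ob) _ _ _)
  assoc t s r := D.sigma_ext (C.assoc _ _ _) _ _
    (D.trivial_assoc (C := C.Ob) t.1 s.1 r.1 t.2 s.2 r.2 _)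

/-- The morphism of `D ⋊ C` given by `ξ ∈ D_f`. -/
def trivialExtension.mk {X Y : O} (f : C.Hom X Y) (ξ : D.grp f) : (trivialExtension D).Hom X Y :=
  ⟨f, ξ⟩

end TrivialExtension

/-! ### Beck modules -/

/-- The category `(CCC_S / C)_ab` of Beck modules over `C`: abelian group objects in `CCC_S / C`. -/
abbrev BeckModule {S : Type u} (C : SortedCCC.{u, v} S) := CommGrp (Over C)

namespace BeckModule

open SortedCCC MonoidalCategory MonObj

variable {S : Type u} {C : SortedCCC.{u, v} S} (M : BeckModule C)

/-- The total category `E` of a Beck module `p : E ⟶ C`. -/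
abbrev total : SortedCCC.{u, v} S := M.X.left

/-- The structure morphism `p : E ⟶ C` of a Beck module. -/
abbrev proj : M.total ⟶ C := M.X.hom

/-- The fibre `p⁻¹(f)`. -/
def Fibre {X Y : BiMag S} (f : C.Hom X Y) : Type v :=
  {t : M.total.Hom X Y // M.proj.functor.map t = f}

/-- The zero element of `p⁻¹(f)`, the value at `f` of the unit `C ⟶ E`. -/
noncomputable def zero {X Y : BiMag S} (f : C.Hom X Y) : M.Fibre f :=
  ⟨(η[M.X]).left.functor.map f,
    congrArg (fun t : C ⟶ C => t.functor.map f) (Over.w η[M.X])⟩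

variable {M} in
/-- The sum of two elements of `p⁻¹(f)`, given by the addition `E ×_C E ⟶ E`. -/
noncomputable def add {X Y : BiMag S} {f : C.Hom X Y} (a b : M.Fibre f) : M.Fibre f :=
  ⟨(μ[M.X]).left.functor.map
      (show (fibreProduct M.proj M.proj).Hom X Y from ⟨(a.1, b.1), a.2.trans b.2.symm⟩),
    (congrArg (fun t : fibreProduct M.proj M.proj ⟶ C => t.functor.map
      (show (fibreProduct M.proj M.proj).Hom X Y from ⟨(a.1, b.1), a.2.trans b.2.symm⟩))
      (Over.w μ[M.X])).trans a.2⟩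

/-- The functor `E ⟶ E'` over `C` underlying a morphism of Beck modules. -/
noncomputable def mapHom {M N : BeckModule C} (φ : M ⟶ N) : M.total ⟶ N.total :=
  ((CommGrp.forget (Over C)).map φ).left

end BeckModule

/-- Data showing that `F` sends `D` to the trivial extension: naturally in `D`, the
category underlying `F D` is `D ⋊ C`, with its projection to `C`, the structure functor `f ↦ 0 ∈ D_{ι f}` from `CFam S`, and
the addition given by the additions of the groups `D_f`. -/
structure TrivialExtensionComparison {S : Type u} {C : SortedCCC.{u, v} S}
    (F : CCNat C ⥤ BeckModule C) where
  iso : ∀ D : CCNat C, trivialExtension D.obj ≅ (F.obj D).total.toCatOn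
  proj : ∀ (D : CCNat C) {X Y : BiMag S} (f : C.Hom X Y) (ξ : D.obj.grp f),
    (F.obj D).proj.functor.map ((iso D).hom.map (trivialExtension.mk D.obj f ξ)) = f
  map_ι : ∀ (D : CCNat C) {X Y : BiMag S} (f : (CFam S).Hom X Y),
    (iso D).hom.map (trivialExtension.mk D.obj (C.ι.map f) 0) = (F.obj D).total.ι.map f
  map_add : ∀ (D : CCNat C) {X Y : BiMag S} (f : C.Hom X Y) (ξ η : D.obj.grp f),
    (iso D).hom.map (trivialExtension.mk D.obj f (ξ + η)) =
      (BeckModule.add (M := F.obj D) ⟨(iso D).hom.map (trivialExtension.mk D.obj f ξ), proj D f ξ⟩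
        ⟨(iso D).hom.map (trivialExtension.mk D.obj f η), proj D f η⟩).1
  naturality : ∀ {D D' : CCNat C} (φ : D ⟶ D') {X Y : BiMag S} (f : C.Hom X Y) (ξ : D.obj.grp f),
    (BeckModule.mapHom (F.map φ)).functor.map ((iso D).hom.map (trivialExtension.mk D.obj f ξ)) =
      (iso D').hom.map (trivialExtension.mk D'.obj f ((φ.hom.app ⟨f⟩).hom ξ))

/-- Data showing that `G` sends a Beck module `p` to the natural system of its fibres:
naturally in `p`, `(G p)_f` is `p⁻¹(f)` with its addition, and `(a, b) : f ⟶ b ∘ f ∘ a` acts by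
`t ↦ 0_b ∘ t ∘ 0_a`. -/
structure FibreComparison {S : Type u} {C : SortedCCC.{u, v} S}
    (G : BeckModule C ⥤ CCNat C) where
  equiv : ∀ (M : BeckModule C) {X Y : BiMag S} (f : C.Hom X Y),
    (G.obj M).obj.grp f ≃ M.Fibre f
  map_add : ∀ (M : BeckModule C) {X Y : BiMag S} (f : C.Hom X Y) (ξ η : (G.obj M).obj.grp f),
    equiv M f (ξ + η) = BeckModule.add (equiv M f ξ) (equiv M f η)
  map_factorization : ∀ (M : BeckModule C) {W X Y Z : BiMag S} (f : C.Hom X Y) (g : C.Hom W Z)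
    (a : C.Hom W X) (b : C.Hom Y Z) (h : C.comp a (C.comp f b) = g) (ξ : (G.obj M).obj.grp f),
    (equiv M g (((G.obj M).obj.map (X := ⟨f⟩) (Y := ⟨g⟩) ⟨a, b, h⟩).hom ξ)).1 =
      M.total.comp (M.zero a).1 (M.total.comp (equiv M f ξ).1 (M.zero b).1)
  naturality : ∀ {M N : BeckModule C} (φ : M ⟶ N) {X Y : BiMag S} (f : C.Hom X Y)
    (ξ : (G.obj M).obj.grp f),
    (equiv N f (((G.map φ).hom.app ⟨f⟩).hom ξ)).1 =
      (BeckModule.mapHom φ).functor.map (equiv M f ξ).1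

/-!
Both functors of the equivalence are written down explicitly: `Ξ` sends `D` to the trivial extension
`D ⋊ C`, and its quasi-inverse sends a Beck module `p : E ⟶ C` to the natural system `D(p)` of its
fibres.

The conditions on `D` are what makes `D ⋊ C` an `S`-sorted cartesian closed category under `CFam S`
via the zero section. A morphism of `D ⋊ C` is a pair `(f, ξ)` with `ξ ∈ D_f`, and composing it with
`(π, 0)` gives `(π ∘ f, π_* ξ)`; hence the specified diagrams of `C` stay terminal or product diagrams
in `D ⋊ C` by cartesianness (`trivialExtension.isTerminal_one`, `trivialExtension.isProd_mk`).
Moreover `(g, ξ) × 1` is `(g × 1, φ_g (ξ, 0))`, so that uncurrying in `D ⋊ C` is the map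
`D_{λ f} → D_f`, and its bijectivity is the universal property of the exponentials
(`trivialExtension.isExponential_mk`). The additions of the groups `D_f` give an abelian group object
over `C`, since composition in `D ⋊ C` is additive in both arguments jointly.

Conversely, let `p : E ⟶ C` be a Beck module. Evaluating the axioms of a group object at single
morphisms makes each fibre `p⁻¹(f)` an abelian group, and the functoriality of the addition says
`(t + t') ≫ (s + s') = t ≫ s + t' ≫ s'` (`BeckModule.Fibre.add_comp_add`), so that `D(p)` is a natural
system. The zero section `C ⟶ E` is a morphism of `CCC_S`, hence carries product cones to product
cones and evaluations to evaluations; as `p` preserves tuples and transposes, the universal properties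
in `E` restrict to the fibres and show that `D(p)` is cartesian closed
(`BeckModule.isCartesian_fibreSystem`, `BeckModule.isCartesianClosed_fibreSystem`).

The fibres of `D ⋊ C ⟶ C` are the groups `D_f`, which gives the unit. For the counit, the map
`D(p) ⋊ C ⟶ E` that forgets the base morphism is bijective on morphisms, and it is a functor because
`t ≫ s = (t + 0) ≫ (0 + s) = t ≫ 0 + 0 ≫ s` (`BeckModule.Fibre.comp_eq`), which is the composition law
of the trivial extension.
-/

/-! ### The trivial extension as a sorted cartesian closed category -/

namespace trivialExtension

section CatOn

variable {O : Type u} {C : CatOn.{u, v} O} (D : NatSystem C.Ob)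

theorem mk_comp_mk_zero {X Y Z : O} {f : C.Hom X Y} {a : C.Hom Y Z} {g : C.Hom X Z}
    (h : C.comp f a = g) (ξ : D.grp f) :
    (trivialExtension D).comp (mk D f ξ) (mk D a 0) = mk D g (D.push (f := f) a h ξ) := by
  subst h
  refine congrArg (mk D (C.comp f a)) ?_
  exact (congrArg (D.push (f := f) a rfl ξ + ·) (map_zero (D.pull (f := a) f rfl))).trans
    (add_zero _)

theorem mk_zero_comp_mk {X Y Z : O} {a : C.Hom X Y} {f : C.Hom Y Z} {g : C.Hom X Z}
    (h : C.comp a f = g) (ξ : D.grp f) :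
    (trivialExtension D).comp (mk D a 0) (mk D f ξ) = mk D g (D.pull (f := f) a h ξ) := by
  subst h
  refine congrArg (mk D (C.comp a f)) ?_
  exact (congrArg (· + D.pull (f := f) a rfl ξ) (map_zero (D.push (f := a) f rfl))).trans
    (zero_add _)

theorem mk_injective {X Y : O} (f : C.Hom X Y) : Function.Injective (mk D f) :=
  fun _ _ h => eq_of_heq (Sigma.mk.inj h).2

/-- The zero section `C ⟶ D ⋊ C`. -/
def zeroSection : IdFunctor C (trivialExtension D) where
  map f := mk D f 0
  map_id _ := rfl
  map_comp _ _ := ((mk_comp_mk_zero D rfl 0).trans (congrArg (mk D _) (map_zero _))).symm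

/-- The functor `D ⋊ C ⟶ D' ⋊ C` induced by a morphism of natural systems. -/
def map {D D' : NatSystem C.Ob} (φ : D ⟶ D') :
    IdFunctor (trivialExtension D) (trivialExtension D') where
  map t := mk D' t.1 ((φ.app ⟨t.1⟩).hom t.2)
  map_id X := congrArg (mk D' (C.id X)) (map_zero _)
  map_comp t s := by
    refine congrArg (mk D' (C.comp t.1 s.1)) ((map_add _ _ _).trans ?_)
    exact congrArg₂ (· + ·)
      (congrArg (fun m => m.hom t.2) (φ.naturality (X := ⟨t.1⟩) (Y := ⟨C.comp t.1 s.1⟩) _))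
      (congrArg (fun m => m.hom s.2) (φ.naturality (X := ⟨s.1⟩) (Y := ⟨C.comp t.1 s.1⟩) _))

end CatOn

open SortedCCC NatSystem

variable {S : Type u} {C : SortedCCC.{u, v} S} {D : NatSystem C.Ob}

/-- Cartesianness for the empty product says that `D_f` is trivial for `f : X ⟶ 1`; thus `1` stays
terminal. -/
theorem isTerminal_one (hD : D.IsCartesian) :
    Nonempty (IsTerminal (C := (trivialExtension D).Ob) (BiMag.one : BiMag S)) := by
  obtain ⟨t⟩ := C.isTerminal
  refine ⟨IsTerminal.ofUniqueHom (fun X => mk D (t.from X) 0) ?_⟩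
  rintro X ⟨f, ξ⟩
  obtain rfl : f = t.from X := t.hom_ext _ _
  have key := hD PEmpty (fun j => j.elim)
    (Fan.mk (C := C.Ob) (BiMag.one : BiMag S) (fun j => j.elim))
    ⟨Fan.IsLimit.mk _ (fun s => t.from _) (fun _ j => j.elim) (fun _ _ _ => t.hom_ext _ _)⟩
    X (t.from X)
  exact congrArg (mk D _) (key.1 (funext fun j => j.elim))

/-- Morphisms of `D ⋊ C` into a product are determined by their components: injectivity of
`D_f → D_{π₁ ∘ f} × D_{π₂ ∘ f}`. -/
theorem prod_hom_ext (hD : D.IsCartesian) {W X Y : BiMag S}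
    {k l : (trivialExtension D).Hom W (.prod X Y)}
    (h1 : (trivialExtension D).comp k (mk D (C.fst X Y) 0) =
      (trivialExtension D).comp l (mk D (C.fst X Y) 0))
    (h2 : (trivialExtension D).comp k (mk D (C.snd X Y) 0) =
      (trivialExtension D).comp l (mk D (C.snd X Y) 0)) : k = l := by
  obtain ⟨k, ξ⟩ := k
  obtain ⟨l, η⟩ := l
  obtain rfl : k = l := SortedCCC.prod_hom_ext (congrArg Sigma.fst h1) (congrArg Sigma.fst h2)
  refine congrArg (mk D k) ((hD.bijective_prod k rfl rfl).1 (Prod.ext ?_ ?_))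
  · exact mk_injective D _ ((mk_comp_mk_zero D rfl ξ).symm.trans
      (h1.trans (mk_comp_mk_zero D rfl η)))
  · exact mk_injective D _ ((mk_comp_mk_zero D rfl ξ).symm.trans
      (h2.trans (mk_comp_mk_zero D rfl η)))

/-- Cartesianness for binary products says that the projections of `C` remain product projections
in `D ⋊ C`. -/
theorem isProd_mk (hD : D.IsCartesian) (X Y : BiMag S) :
    IsProd (C := (trivialExtension D).Ob) (mk D (C.fst X Y) 0) (mk D (C.snd X Y) 0) := by
  refine (isProd_iff _ _).2 ?_
  rintro W ⟨f, ξ⟩ ⟨g, η⟩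
  obtain ⟨ζ, hζ⟩ := (hD.bijective_prod (lift f g) (lift_fst f g) (lift_snd f g)).2 (ξ, η)
  have h1 : (trivialExtension D).comp (mk D (lift f g) ζ) (mk D (C.fst X Y) 0) = mk D f ξ :=
    (mk_comp_mk_zero D (lift_fst f g) ζ).trans (congrArg (mk D f) (congrArg Prod.fst hζ))
  have h2 : (trivialExtension D).comp (mk D (lift f g) ζ) (mk D (C.snd X Y) 0) = mk D g η :=
    (mk_comp_mk_zero D (lift_snd f g) ζ).trans (congrArg (mk D g) (congrArg Prod.snd hζ))
  exact ⟨mk D (lift f g) ζ, ⟨h1, h2⟩,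
    fun m hm => prod_hom_ext hD (hm.1.trans h1.symm) (hm.2.trans h2.symm)⟩

end trivialExtension

namespace NatSystem

open SortedCCC

variable {S : Type u} {C : SortedCCC.{u, v} S} {D : NatSystem C.Ob}

/-- `φ_g (ξ, η)` is characterized by its images under the two projections. -/
theorem phi_eq_iff (hD : D.IsCartesian) {X W : BiMag S} (g : C.Hom X W) (Y : BiMag S)
    (ξ : D.grp g) (η : D.grp (C.snd X Y)) (ζ : D.grp (prodId g Y)) :
    phi hD g Y (ξ, η) = ζ ↔
      D.push (f := prodId g Y) (C.fst W Y) (lift_fst _ _) ζ =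
          D.pull (f := g) (g := C.comp (C.fst X Y) g) (C.fst X Y) rfl ξ ∧
        D.push (f := prodId g Y) (C.snd W Y) (lift_snd _ _) ζ = η := by
  refine (AddEquiv.symm_apply_eq (AddEquiv.ofBijective _ (hD.bijective_prod (prodId g Y)
    (lift_fst (C.comp (C.fst X Y) g) _) (lift_snd _ (C.snd X Y))))).trans (eq_comm.trans ?_)
  exact Prod.ext_iff

end NatSystem

namespace trivialExtension

open SortedCCC NatSystem

variable {S : Type u} {C : SortedCCC.{u, v} S} {D : NatSystem C.Ob}

/-- The pair `(g × 1, φ_g (ξ, 0))` has the same first component as `(g, ξ) × 1` in `D ⋊ C`. -/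
theorem comp_mk_phi_mk_fst (hD : D.IsCartesian) {X W : BiMag S} (g : C.Hom X W) (Y : BiMag S)
    (ξ : D.grp g) :
    (trivialExtension D).comp (mk D (prodId g Y) (phi hD g Y (ξ, 0))) (mk D (C.fst W Y) 0) =
      (trivialExtension D).comp (mk D (C.fst X Y) 0) (mk D g ξ) :=
  (mk_comp_mk_zero D (lift_fst _ _) _).trans ((congrArg (mk D _)
    ((phi_eq_iff hD g Y ξ 0 _).1 rfl).1).trans (mk_zero_comp_mk D rfl ξ).symm)

theorem comp_mk_phi_mk_snd (hD : D.IsCartesian) {X W : BiMag S} (g : C.Hom X W) (Y : BiMag S)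
    (ξ : D.grp g) :
    (trivialExtension D).comp (mk D (prodId g Y) (phi hD g Y (ξ, 0))) (mk D (C.snd W Y) 0) =
      mk D (C.snd X Y) 0 :=
  (mk_comp_mk_zero D (lift_snd _ _) _).trans
    (congrArg (mk D _) ((phi_eq_iff hD g Y ξ 0 _).1 rfl).2)

/-- The morphism `ξ × 1` of `D ⋊ C` followed by evaluation is `closedMap ξ`, so that bijectivity of
the maps `D_{λ f} → D_f` says that the evaluations of `C` remain exponentials in `D ⋊ C`. -/
theorem isExponential_mk (hD : D.IsCartesianClosed) (Y Z : BiMag S) :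
    IsExponential (C := (trivialExtension D).Ob) (mk D (C.fst (.exp Y Z) Y) 0)
      (mk D (C.snd (.exp Y Z) Y) 0) (mk D (C.ev Y Z) 0) := by
  have hC := hD.isCartesian
  refine IsExponential.mk_of (isProd_mk hC _ _) fun X => ⟨_, _, _, isProd_mk hC X Y, ?_⟩
  rintro ⟨f, θ⟩
  obtain ⟨ξ, hξ⟩ := (hD.bijective_closedMap f).2 θ
  refine ⟨mk D (curry f) ξ, ⟨mk D (prodId (curry f) Y) (phi hC (curry f) Y (ξ, 0)),
    comp_mk_phi_mk_fst hC _ Y ξ, comp_mk_phi_mk_snd hC _ Y ξ,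
    (mk_comp_mk_zero D (curry_ev f) _).trans (congrArg (mk D f) hξ)⟩, ?_⟩
  rintro ⟨g, ξ'⟩ ⟨h, h1, h2, h3⟩
  obtain rfl : h = mk D (prodId g Y) (phi hC g Y (ξ', 0)) :=
    prod_hom_ext hC (h1.trans (comp_mk_phi_mk_fst hC g Y ξ').symm)
      (h2.trans (comp_mk_phi_mk_snd hC g Y ξ').symm)
  obtain rfl : g = curry f := exp_hom_ext ((congrArg Sigma.fst h3).trans (curry_ev f).symm)
  refine congrArg (mk D (curry f)) ((hD.bijective_closedMap f).1 ?_)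
  exact (mk_injective D f ((mk_comp_mk_zero D (curry_ev f) _).symm.trans h3)).trans hξ.symm

end trivialExtension

namespace CCNat

variable {S : Type u} {C : SortedCCC.{u, v} S}

/-- The functor `CFam S ⟶ D ⋊ C`, `f ↦ 0 ∈ D_{ι f}`. -/
def extensionι (D : NatSystem C.Ob) : IdFunctor (CFam S) (trivialExtension D) where
  map f := trivialExtension.mk D (C.ι.map f) 0
  map_id X := congrArg (fun f => trivialExtension.mk D f 0) (C.ι.map_id X)
  map_comp f g := (congrArg (fun f => trivialExtension.mk D f 0) (C.ι.map_comp f g)).trans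
    ((trivialExtension.zeroSection D).map_comp (C.ι.map f) (C.ι.map g))

/-- The trivial extension of a cartesian closed natural system, as an `S`-sorted cartesian closed
category. -/
def extension (D : CCNat C) : SortedCCC.{u, v} S :=
  SortedCCC.mk' (trivialExtension D.obj) (extensionι D.obj)
    (trivialExtension.isTerminal_one D.property.isCartesian)
    (fun X Y => trivialExtension.isProd_mk D.property.isCartesian X Y)
    (fun Y Z => trivialExtension.isExponential_mk D.property Y Z)

/-- The projection `D ⋊ C ⟶ C`. -/
def extensionProj (D : CCNat C) : extension D ⟶ C :=
  SortedCCC.Mor.mk' (A := extension D) (B := C) ⟨fun f => Sigma.fst f, fun _ => rfl, fun _ _ => rfl⟩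
    fun _ => rfl

/-- The trivial extension as an object over `C`. -/
abbrev extensionOver (D : CCNat C) : Over C := Over.mk (extensionProj D)

end CCNat

/-! ### The group structure on the trivial extension -/

namespace SortedCCC

theorem over_hom_ext {S : Type u} {C : SortedCCC.{u, v} S} {M N : Over C} {F G : M ⟶ N}
    (h : ∀ (X Y : BiMag S) (f : M.left.Hom X Y), F.left.functor.map f = G.left.functor.map f) :
    F = G :=
  Over.OverMorphism.ext (SortedCCC.hom_ext h)

end SortedCCC

namespace CCNat

open SortedCCC MonoidalCategory CartesianMonoidalCategory

variable {S : Type u} {C : SortedCCC.{u, v} S}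

/-- The morphism of the fibre product `(D ⋊ C) ×_C (D ⋊ C)` given by two elements of `D_f`. -/
def mkPair (D : CCNat C) {X Y : BiMag S} {f : C.Hom X Y} (ξ η : D.obj.grp f) :
    (fibreProduct (extensionProj D) (extensionProj D)).Hom X Y :=
  ⟨(trivialExtension.mk D.obj f ξ, trivialExtension.mk D.obj f η), rfl⟩

/-- Every morphism of the fibre product is of the form `mkPair D ξ η`, so that the cast in the
addition of `D ⋊ C` need never be computed. -/
theorem mkPair_induction (D : CCNat C) {X Y : BiMag S}
    {P : (fibreProduct (extensionProj D) (extensionProj D)).Hom X Y → Prop}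
    (h : ∀ (f : C.Hom X Y) (ξ η : D.obj.grp f), P (mkPair D ξ η)) (t) : P t := by
  obtain ⟨⟨⟨f, ξ⟩, ⟨g, η⟩⟩, hfg⟩ := t
  change f = g at hfg
  subst hfg
  exact h f ξ η

/-- The sum of two morphisms of `D ⋊ C` over the same morphism of `C`. The cast moves the second
summand into the group of the first; on `mkPair D ξ η` it is the identity by definition. -/
def sum (D : CCNat C) {X Y : BiMag S}
    (t : (fibreProduct (extensionProj D) (extensionProj D)).Hom X Y) : (extension D).Hom X Y :=
  let a : (trivialExtension D.obj).Hom X Y := t.1.1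
  let b : (trivialExtension D.obj).Hom X Y := t.1.2
  have h : b.1 = a.1 := t.2.symm
  trivialExtension.mk D.obj a.1
    (a.2 + cast (congrArg (fun f : C.Hom X Y => (D.obj.grp f : Type v)) h) b.2)

/-- The addition `(D ⋊ C) ×_C (D ⋊ C) ⟶ D ⋊ C`. It is a functor because composition in `D ⋊ C` is
additive in both arguments jointly. -/
def addition (D : CCNat C) : fibreProduct (extensionProj D) (extensionProj D) ⟶ extension D :=
  SortedCCC.Mor.mk' (B := extension D)
    { map := sum D
      map_id := fun X => congrArg (trivialExtension.mk D.obj (C.id X)) (add_zero _)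
      map_comp := fun {X Y Z} t s => by
        induction t using mkPair_induction with | h f ξ ξ'
        induction s using mkPair_induction with | h g η η'
        refine congrArg (trivialExtension.mk D.obj (C.comp f g)) ?_
        exact (add_add_add_comm _ _ _ _).trans
          (congrArg₂ (· + ·) (map_add _ _ _).symm (map_add _ _ _).symm) }
    fun f => congrArg (trivialExtension.mk D.obj (C.ι.map f)) (add_zero _)

/-- The zero section `C ⟶ D ⋊ C` as a morphism of `S`-sorted cartesian closed categories. -/
def zeroMor (D : CCNat C) : C ⟶ extension D :=
  SortedCCC.Mor.mk' (B := extension D) (trivialExtension.zeroSection D.obj) fun _ => rfl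

/-- The negation `D ⋊ C ⟶ D ⋊ C`. -/
def negation (D : CCNat C) : extension D ⟶ extension D :=
  SortedCCC.Mor.mk' (A := extension D) (B := extension D)
    { map := fun {X Y} (t : (trivialExtension D.obj).Hom X Y) =>
        trivialExtension.mk D.obj t.1 (-t.2)
      map_id := fun X => congrArg (trivialExtension.mk D.obj (C.id X)) neg_zero
      map_comp := fun {X Y Z} (t : (trivialExtension D.obj).Hom X Y)
          (s : (trivialExtension D.obj).Hom Y Z) => by
        refine congrArg (trivialExtension.mk D.obj (C.comp t.1 s.1)) ?_
        exact (neg_add _ _).trans (congrArg₂ (· + ·) (map_neg _ _).symm (map_neg _ _).symm) }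
    fun f => congrArg (trivialExtension.mk D.obj (C.ι.map f)) neg_zero

/-- The abelian group structure of `D ⋊ C` over `C`. As the tensor product of `Over C` is the fibre
product, each axiom can be checked on the morphisms of an iterated fibre product, where it becomes
the corresponding axiom for the groups `D_f`. -/
noncomputable instance grpObj (D : CCNat C) : GrpObj (extensionOver D) where
  one := Over.homMk (zeroMor D) (SortedCCC.hom_ext fun _ _ _ => rfl)
  mul := Over.homMk (addition D) (SortedCCC.hom_ext fun _ _ _ => rfl)
  inv := Over.homMk (negation D) (SortedCCC.hom_ext fun _ _ _ => rfl)
  one_mul := over_hom_ext fun X Y t => by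
    obtain ⟨⟨f, ⟨g, ξ⟩⟩, h⟩ := t
    change f = g at h
    subst h
    exact congrArg (trivialExtension.mk D.obj f) (zero_add _)
  mul_one := over_hom_ext fun X Y t => by
    obtain ⟨⟨⟨g, ξ⟩, f⟩, h⟩ := t
    change g = f at h
    subst h
    exact congrArg (trivialExtension.mk D.obj g) (add_zero _)
  mul_assoc := over_hom_ext fun X Y t => by
    obtain ⟨⟨⟨⟨⟨f, ξ⟩, ⟨g, η⟩⟩, h⟩, ⟨k, ζ⟩⟩, h'⟩ := t
    change f = g at h
    subst h
    change f = k at h'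
    subst h'
    exact congrArg (trivialExtension.mk D.obj f) (add_assoc _ _ _)
  left_inv := over_hom_ext fun X Y (t : (trivialExtension D.obj).Hom X Y) =>
    congrArg (trivialExtension.mk D.obj t.1) (neg_add_cancel t.2)
  right_inv := over_hom_ext fun X Y (t : (trivialExtension D.obj).Hom X Y) =>
    congrArg (trivialExtension.mk D.obj t.1) (add_neg_cancel t.2)

instance isCommMonObj (D : CCNat C) : IsCommMonObj (extensionOver D) where
  mul_comm := over_hom_ext fun X Y t => by
    induction t using mkPair_induction D with | h f ξ η
    exact congrArg (trivialExtension.mk D.obj f) (add_comm _ _)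

/-- The Beck module `D ⋊ C ⟶ C`. -/
noncomputable def toBeckModule (D : CCNat C) : BeckModule C := ⟨extensionOver D⟩

/-- The functor `D ⋊ C ⟶ D' ⋊ C` over `C` induced by a morphism of natural systems. -/
def extensionMap {D D' : CCNat C} (φ : D ⟶ D') : extensionOver D ⟶ extensionOver D' :=
  Over.homMk (SortedCCC.Mor.mk' (A := extension D) (B := extension D')
    (trivialExtension.map φ.hom)
    fun f => congrArg (trivialExtension.mk D'.obj (C.ι.map f)) (map_zero _))
    (SortedCCC.hom_ext fun _ _ _ => rfl)

instance isMonHom_extensionMap {D D' : CCNat C} (φ : D ⟶ D') : IsMonHom (extensionMap φ) where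
  one_hom := over_hom_ext fun X Y f =>
    congrArg (trivialExtension.mk D'.obj f) (map_zero (φ.hom.app ⟨f⟩).hom)
  mul_hom := over_hom_ext fun X Y t => by
    induction t using mkPair_induction D with | h f ξ η
    exact congrArg (trivialExtension.mk D'.obj f) (map_add (φ.hom.app ⟨f⟩).hom ξ η)

end CCNat

open CCNat in
/-- The morphism of Beck modules induced by a morphism of natural systems. -/
noncomputable def toBeckModuleMap {S : Type u} {C : SortedCCC.{u, v} S} {D D' : CCNat C}
    (φ : D ⟶ D') : toBeckModule D ⟶ toBeckModule D' :=
  InducedCategory.homMk (Grp.ofHom (A := extensionOver D) (B := extensionOver D') (extensionMap φ))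

open SortedCCC CCNat in
/-- The functor `Ξ`, which sends a cartesian closed natural system `D` to `D ⋊ C ⟶ C`. -/
noncomputable def trivialExtensionFunctor {S : Type u} (C : SortedCCC.{u, v} S) :
    CCNat C ⥤ BeckModule C where
  obj := toBeckModule
  map := toBeckModuleMap
  map_id _ := CommGrp.hom_ext _ _ (over_hom_ext fun _ _ _ => rfl)
  map_comp _ _ := CommGrp.hom_ext _ _ (over_hom_ext fun _ _ _ => rfl)

open CCNat in
/-- The total category of `Ξ D` is `D ⋊ C` by definition. -/
noncomputable def trivialExtensionComparison {S : Type u} (C : SortedCCC.{u, v} S) :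
    TrivialExtensionComparison (trivialExtensionFunctor C) where
  iso D := Iso.refl (trivialExtension D.obj)
  proj _ _ _ _ _ := rfl
  map_ι _ _ _ _ := rfl
  map_add _ _ _ _ _ _ := rfl
  naturality _ _ _ _ _ := rfl

/-! ### The natural system of fibres of a Beck module -/

namespace BeckModule

open SortedCCC MonoidalCategory CartesianMonoidalCategory

variable {S : Type u} {C : SortedCCC.{u, v} S} (M : BeckModule C)

/-- The zero section `C ⟶ E`. -/
noncomputable def zeroMor : C ⟶ M.total := (MonObj.one (X := M.X)).left

theorem zero_id (X : BiMag S) : (M.zero (C.id X)).1 = M.total.id X := M.zeroMor.functor.map_id X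

theorem zero_comp {X Y Z : BiMag S} (f : C.Hom X Y) (g : C.Hom Y Z) :
    (M.zero (C.comp f g)).1 = M.total.comp (M.zero f).1 (M.zero g).1 :=
  M.zeroMor.functor.map_comp f g

theorem zero_fst (X Y : BiMag S) : (M.zero (C.fst X Y)).1 = M.total.fst X Y := map_fst M.zeroMor X Y

theorem zero_snd (X Y : BiMag S) : (M.zero (C.snd X Y)).1 = M.total.snd X Y := map_snd M.zeroMor X Y

theorem zero_ev (Y Z : BiMag S) : (M.zero (C.ev Y Z)).1 = M.total.ev Y Z := map_ev M.zeroMor Y Z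

variable {M}

/-- The left unit axiom of the group object, evaluated at the pair `(f, a)`. The remaining axioms
for the fibres are obtained in the same way. -/
protected theorem zero_add {X Y : BiMag S} {f : C.Hom X Y} (a : M.Fibre f) : add (M.zero f) a = a :=
  Subtype.ext (congrArg (fun F : 𝟙_ (Over C) ⊗ M.X ⟶ M.X => F.left.functor.map
    (show (fibreProduct (𝟙 C) M.proj).Hom X Y from ⟨(f, a.1), a.2.symm⟩)) (MonObj.one_mul M.X))

protected theorem add_assoc {X Y : BiMag S} {f : C.Hom X Y} (a b c : M.Fibre f) :
    add (add a b) c = add a (add b c) :=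
  Subtype.ext (congrArg (fun F : (M.X ⊗ M.X) ⊗ M.X ⟶ M.X => F.left.functor.map
    (show (fibreProduct (fibreProductFst M.proj M.proj ≫ M.proj) M.proj).Hom X Y from
      ⟨(⟨(a.1, b.1), a.2.trans b.2.symm⟩, c.1), a.2.trans c.2.symm⟩)) (MonObj.mul_assoc M.X))

protected theorem add_comm {X Y : BiMag S} {f : C.Hom X Y} (a b : M.Fibre f) : add a b = add b a :=
  Subtype.ext (congrArg (fun F : M.X ⊗ M.X ⟶ M.X => F.left.functor.map
    (show (fibreProduct M.proj M.proj).Hom X Y from ⟨(b.1, a.1), b.2.trans a.2.symm⟩))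
    (IsCommMonObj.mul_comm M.X))

/-- The negative of an element of `p⁻¹(f)`. -/
noncomputable def neg {X Y : BiMag S} {f : C.Hom X Y} (a : M.Fibre f) : M.Fibre f :=
  ⟨(GrpObj.inv (X := M.X)).left.functor.map a.1,
    (congrArg (fun t : M.total ⟶ C => t.functor.map a.1)
      (Over.w (GrpObj.inv (X := M.X)))).trans a.2⟩

protected theorem neg_add_cancel {X Y : BiMag S} {f : C.Hom X Y} (a : M.Fibre f) :
    add (neg a) a = M.zero f :=
  Subtype.ext ((congrArg (fun F : M.X ⟶ M.X => F.left.functor.map a.1)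
    (GrpObj.left_inv M.X)).trans (congrArg M.zeroMor.functor.map a.2))

noncomputable instance {X Y : BiMag S} (f : C.Hom X Y) : Add (M.Fibre f) := ⟨add⟩

noncomputable instance {X Y : BiMag S} (f : C.Hom X Y) : Zero (M.Fibre f) := ⟨M.zero f⟩

noncomputable instance {X Y : BiMag S} (f : C.Hom X Y) : Neg (M.Fibre f) := ⟨neg⟩

noncomputable instance {X Y : BiMag S} (f : C.Hom X Y) : AddCommGroup (M.Fibre f) where
  add_assoc := BeckModule.add_assoc
  zero_add := BeckModule.zero_add
  add_zero a := (BeckModule.add_comm a (M.zero f)).trans (BeckModule.zero_add a)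
  add_comm := BeckModule.add_comm
  neg_add_cancel := BeckModule.neg_add_cancel
  nsmul := nsmulRec
  zsmul := zsmulRec

/-- The composite of elements of `p⁻¹(f)` and `p⁻¹(g)`. -/
def Fibre.comp {X Y Z : BiMag S} {f : C.Hom X Y} {g : C.Hom Y Z} (a : M.Fibre f) (b : M.Fibre g) :
    M.Fibre (C.comp f g) :=
  ⟨M.total.comp a.1 b.1, (M.proj.functor.map_comp _ _).trans (congrArg₂ C.comp a.2 b.2)⟩

/-- Functoriality of the addition `E ×_C E ⟶ E`. -/
theorem Fibre.add_comp_add {X Y Z : BiMag S} {f : C.Hom X Y} {g : C.Hom Y Z} (a a' : M.Fibre f)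
    (b b' : M.Fibre g) : (a + a').comp (b + b') = a.comp b + a'.comp b' :=
  Subtype.ext ((MonObj.mul (X := M.X)).left.functor.map_comp
    (show (fibreProduct M.proj M.proj).Hom X Y from ⟨(a.1, a'.1), a.2.trans a'.2.symm⟩)
    (show (fibreProduct M.proj M.proj).Hom Y Z from ⟨(b.1, b'.1), b.2.trans b'.2.symm⟩)).symm

/-- By functoriality of the addition, `t ≫ s = (t + 0) ≫ (0 + s) = t ≫ 0 + 0 ≫ s`: composition in
a Beck module is given by the formula that defines composition in a trivial extension. -/
theorem Fibre.comp_eq {X Y Z : BiMag S} {f : C.Hom X Y} {g : C.Hom Y Z} (a : M.Fibre f)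
    (b : M.Fibre g) : a.comp b = a.comp (M.zero g) + (M.zero f).comp b := by
  refine (congrArg₂ Fibre.comp (add_zero a) (zero_add b)).symm.trans ?_
  exact Fibre.add_comp_add a 0 0 b

variable (M) in
/-- The action `t ↦ 0_b ∘ t ∘ 0_a` of a factorization. -/
noncomputable def action {W X Y Z : BiMag S} (f : C.Hom X Y) {g : C.Hom W Z} (a : C.Hom W X)
    (b : C.Hom Y Z) (h : C.comp a (C.comp f b) = g) : M.Fibre f →+ M.Fibre g where
  toFun t := ⟨M.total.comp (M.zero a).1 (M.total.comp t.1 (M.zero b).1),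
    (((M.zero a).comp (t.comp (M.zero b))).2).trans h⟩
  map_zero' := by
    subst h
    refine Subtype.ext ?_
    exact ((M.zero_comp a (C.comp f b)).trans (congrArg _ (M.zero_comp f b))).symm
  map_add' t t' := by
    subst h
    -- composition with a fixed zero element is additive, because `0 = 0 + 0`
    have h1 : (t + t').comp (M.zero b) = t.comp (M.zero b) + t'.comp (M.zero b) :=
      (congrArg ((t + t').comp) (zero_add (0 : M.Fibre b))).symm.trans
        (Fibre.add_comp_add t t' 0 0)
    have h2 (s s' : M.Fibre (C.comp f b)) :
        (M.zero a).comp (s + s') = (M.zero a).comp s + (M.zero a).comp s' :=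
      (congrArg (Fibre.comp · (s + s')) (zero_add (0 : M.Fibre a))).symm.trans
        (Fibre.add_comp_add 0 0 s s')
    exact (congrArg (M.zero a).comp h1).trans (h2 _ _)

variable (M) in
/-- The group `p⁻¹(f)` as a bundled abelian group. The arguments are typed by `BiMag S` rather than
by `C.Ob`, where the group structure would not be found by instance search. -/
noncomputable def fibreGrp {X Y : BiMag S} (f : C.Hom X Y) : AddCommGrpCat.{v} := .of (M.Fibre f)

variable (M) in
/-- The action of a factorization, as a morphism of abelian groups. -/
noncomputable def actionHom {W X Y Z : BiMag S} (f : C.Hom X Y) {g : C.Hom W Z} (a : C.Hom W X)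
    (b : C.Hom Y Z) (h : C.comp a (C.comp f b) = g) : M.fibreGrp f ⟶ M.fibreGrp g :=
  AddCommGrpCat.ofHom (M.action f a b h)

variable (M) in
/-- The natural system `D(p)` of a Beck module `p`, with `D(p)_f = p⁻¹(f)`. -/
noncomputable def fibreSystem : NatSystem C.Ob where
  obj f := M.fibreGrp f.arrow
  map {f g} k := M.actionHom f.arrow k.left k.right k.w
  map_id f := by
    refine AddCommGrpCat.hom_ext (AddMonoidHom.ext fun t => Subtype.ext ?_)
    refine (congrArg₂ (fun a b => M.total.comp a (M.total.comp t.1 b)) (M.zero_id f.dom)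
      (M.zero_id f.cod)).trans ?_
    exact (M.total.id_comp _).trans (M.total.comp_id _)
  map_comp {f g k} m n := by
    refine AddCommGrpCat.hom_ext (AddMonoidHom.ext fun t => Subtype.ext ?_)
    refine (congrArg₂ (fun a b => M.total.comp a (M.total.comp t.1 b))
      (M.zero_comp n.left m.left) (M.zero_comp m.right n.right)).trans ?_
    refine (M.total.assoc _ _ _).trans (congrArg (M.total.comp (M.zero n.left).1) ?_)
    exact (congrArg (M.total.comp _) (M.total.assoc _ _ _).symm).trans (M.total.assoc _ _ _).symm

/-- The morphism of `E` underlying an element of `D(p)_f`. -/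
def val {X Y : BiMag S} {f : C.Hom X Y} (t : M.fibreSystem.grp f) : M.total.Hom X Y :=
  Subtype.val (p := fun s => M.proj.functor.map s = f) t

theorem val_injective {X Y : BiMag S} {f : C.Hom X Y} :
    Function.Injective (val : M.fibreSystem.grp f → M.total.Hom X Y) := Subtype.val_injective

theorem push_val {X Y Z : BiMag S} {f : C.Hom X Y} (a : C.Hom Y Z) {g : C.Hom X Z}
    (h : C.comp f a = g) (t : M.fibreSystem.grp f) :
    val (M.fibreSystem.push (f := f) (g := g) a h t) = M.total.comp (val t) (M.zero a).1 :=
  (congrArg (fun k => M.total.comp k (M.total.comp (val t) (M.zero a).1)) (M.zero_id X)).trans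
    (M.total.id_comp _)

theorem pull_val {W X Y : BiMag S} {f : C.Hom X Y} (a : C.Hom W X) {g : C.Hom W Y}
    (h : C.comp a f = g) (t : M.fibreSystem.grp f) :
    val (M.fibreSystem.pull (f := f) (g := g) a h t) = M.total.comp (M.zero a).1 (val t) :=
  congrArg (M.total.comp (M.zero a).1)
    ((congrArg (M.total.comp (val t)) (M.zero_id Y)).trans (M.total.comp_id _))

variable (M) in
/-- The zero section preserves finite products, so that the image of a product cone of `C` is a
product cone of `E`, whose universal property restricts to the fibres of `E ⟶ C`. -/
theorem isCartesian_fibreSystem : M.fibreSystem.IsCartesian := by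
  intro J _ X P ⟨hP⟩ A f
  have := M.zeroMor.closed.preservesFiniteProducts
  have hE := isLimitOfPreserves M.zeroMor.functor.toFunctor hP
  constructor
  · intro s t hst
    refine val_injective (hE.hom_ext fun ⟨j⟩ => ?_)
    have h := congrArg val (congrFun hst j)
    exact (push_val (P.proj j) rfl s).symm.trans (h.trans (push_val (P.proj j) rfl t))
  · intro t
    let c : Cone (Discrete.functor X ⋙ M.zeroMor.functor.toFunctor) :=
      { pt := A
        π := Discrete.natTrans fun j => (t j.as).1 }
    have hl (j : J) : M.total.comp (hE.lift c) (M.zero (P.proj j)).1 = (t j).1 :=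
      hE.fac c ⟨j⟩
    -- the lift lies over `f`, because its composites with the projections do
    have hp : M.proj.functor.map (hE.lift c) = f := by
      refine hP.hom_ext fun ⟨j⟩ => ?_
      refine Eq.trans ?_ (t j).2
      refine Eq.trans ?_ (congrArg M.proj.functor.map (hl j))
      exact (congrArg (C.comp _) (M.zero (P.proj j)).2).symm.trans
        (M.proj.functor.map_comp _ _).symm
    exact ⟨⟨hE.lift c, hp⟩,
      funext fun j => val_injective ((push_val (P.proj j) rfl _).trans (hl j))⟩

/-- In the natural system of fibres, `φ_g (t, 0)` is `t × 1`. -/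
theorem phi_val {X W : BiMag S} (g : C.Hom X W) (Y : BiMag S) (t : M.fibreSystem.grp g) :
    val (NatSystem.phi M.isCartesian_fibreSystem g Y (t, 0)) = prodId (val t) Y := by
  have hp : M.proj.functor.map (prodId (val t) Y) = prodId g Y :=
    (map_prodId M.proj (val t) Y).trans (congrArg (prodId · Y) (Subtype.property t))
  let s : M.Fibre (prodId g Y) := ⟨prodId (val t) Y, hp⟩
  refine congrArg val (a₂ := s)
    ((NatSystem.phi_eq_iff M.isCartesian_fibreSystem g Y t 0 s).2
      ⟨val_injective ?_, val_injective ?_⟩)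
  · refine (push_val _ _ _).trans (Eq.trans ?_ (pull_val _ _ _).symm)
    rw [zero_fst, zero_fst]
    exact lift_fst _ _
  · refine (push_val _ _ _).trans ?_
    rw [zero_snd]
    exact (lift_snd _ _).trans (M.zero_snd X Y).symm

/-- In the natural system of fibres, the map `D_{λ f} → D_f` is uncurrying in `E`. -/
theorem closedMap_val {X Y Z : BiMag S} (f : C.Hom (.prod X Y) Z)
    (t : M.fibreSystem.grp (curry f)) :
    val (NatSystem.closedMap M.isCartesian_fibreSystem f t) =
      M.total.comp (prodId (val t) Y) (M.total.ev Y Z) :=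
  (push_val _ (curry_ev f) _).trans (congrArg₂ M.total.comp (phi_val _ Y t) (M.zero_ev Y Z))

variable (M) in
/-- Transposition in `E` inverts the maps `D_{λ f} → D_f`, since `p` preserves transposes. -/
theorem isCartesianClosed_fibreSystem : M.fibreSystem.IsCartesianClosed where
  isCartesian := M.isCartesian_fibreSystem
  bijective_closedMap f := by
    constructor
    · intro s t hst
      refine val_injective (exp_hom_ext ?_)
      exact (closedMap_val f s).symm.trans ((congrArg val hst).trans (closedMap_val f t))
    · intro t
      have hp : M.proj.functor.map (curry (val t)) = curry f :=
        (map_curry M.proj (val t)).trans (congrArg curry (Subtype.property t))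
      exact ⟨⟨curry (val t), hp⟩, val_injective ((closedMap_val f _).trans (curry_ev (val t)))⟩

variable (M) in
/-- The natural system of fibres, as a cartesian closed natural system. -/
noncomputable def toCCNat : CCNat C := ⟨M.fibreSystem, M.isCartesianClosed_fibreSystem⟩

section Map

variable {N : BeckModule C} (φ : M ⟶ N)

/-- The map of fibres induced by a morphism of Beck modules. -/
noncomputable def fibreMap {X Y : BiMag S} (f : C.Hom X Y) (t : M.Fibre f) : N.Fibre f :=
  ⟨(mapHom φ).functor.map t.1, (congrArg (fun F : M.total ⟶ C => F.functor.map t.1)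
    (Over.w φ.hom.hom.hom)).trans t.2⟩

theorem mapHom_zero {X Y : BiMag S} (f : C.Hom X Y) :
    (mapHom φ).functor.map (M.zero f).1 = (N.zero f).1 :=
  congrArg (fun F : 𝟙_ (Over C) ⟶ N.X => F.left.functor.map f) (IsMonHom.one_hom φ.hom.hom.hom)

theorem fibreMap_add {X Y : BiMag S} (f : C.Hom X Y) (s t : M.Fibre f) :
    fibreMap φ f (s + t) = fibreMap φ f s + fibreMap φ f t :=
  Subtype.ext (congrArg (fun F : M.X ⊗ M.X ⟶ N.X => F.left.functor.map
    (show (fibreProduct M.proj M.proj).Hom X Y from ⟨(s.1, t.1), s.2.trans t.2.symm⟩))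
    (IsMonHom.mul_hom φ.hom.hom.hom))

/-- The map of fibres, as a morphism of abelian groups. -/
noncomputable def fibreMapHom {X Y : BiMag S} (f : C.Hom X Y) : M.fibreGrp f ⟶ N.fibreGrp f :=
  AddCommGrpCat.ofHom (AddMonoidHom.mk' (fibreMap φ f) (fibreMap_add φ f))

/-- The morphism of natural systems of fibres induced by a morphism of Beck modules. -/
noncomputable def toCCNatMap : M.toCCNat ⟶ N.toCCNat :=
  ObjectProperty.homMk
    { app := fun f => fibreMapHom φ f.arrow
      naturality := fun f g k => by
        refine AddCommGrpCat.hom_ext (AddMonoidHom.ext fun t => Subtype.ext ?_)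
        refine ((mapHom φ).functor.map_comp _ _).trans ?_
        refine congrArg₂ N.total.comp (mapHom_zero φ k.left) ?_
        exact ((mapHom φ).functor.map_comp _ _).trans
          (congrArg (N.total.comp _) (mapHom_zero φ k.right)) }

end Map

end BeckModule

open BeckModule in
/-- The functor which sends a Beck module to its natural system of fibres. -/
noncomputable def fibreFunctor {S : Type u} (C : SortedCCC.{u, v} S) : BeckModule C ⥤ CCNat C where
  obj := toCCNat
  map φ := toCCNatMap φ
  map_id _ := rfl
  map_comp _ _ := rfl

/-- The value at `f` of the natural system of fibres is `p⁻¹(f)` by definition. -/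
noncomputable def fibreComparison {S : Type u} (C : SortedCCC.{u, v} S) :
    FibreComparison (fibreFunctor C) where
  equiv _ _ _ _ := Equiv.refl _
  map_add _ _ _ _ _ _ := rfl
  map_factorization _ _ _ _ _ _ _ _ _ _ _ := rfl
  naturality _ _ _ _ _ := rfl

/-! ### The equivalence -/

namespace CCNat

open SortedCCC BeckModule

variable {S : Type u} {C : SortedCCC.{u, v} S}

/-- The fibre of `D ⋊ C ⟶ C` over `f` is `D_f`. -/
noncomputable def fibreEquiv (D : CCNat C) {X Y : BiMag S} (f : C.Hom X Y) :
    D.obj.grp f ≃+ (toBeckModule D).Fibre f where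
  toFun ξ := ⟨trivialExtension.mk D.obj f ξ, rfl⟩
  invFun t := cast (congrArg (fun g : C.Hom X Y => (D.obj.grp g : Type v)) t.2) t.1.2
  left_inv _ := rfl
  right_inv := by
    rintro ⟨⟨g, ξ⟩, h⟩
    change g = f at h
    subst h
    rfl
  map_add' _ _ := rfl

/-- The isomorphism of `D_f` with the fibre of `D ⋊ C ⟶ C` over `f`. -/
noncomputable def fibreIso (D : CCNat C) {X Y : BiMag S} (f : C.Hom X Y) :
    D.obj.grp f ≅ (toBeckModule D).fibreGrp f :=
  (fibreEquiv D f).toAddCommGrpIso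

/-- The formula for the action of `(a, b)` on an element `ξ` of `D_f` in terms of composition in
`D ⋊ C`. -/
theorem mk_map {W X Y Z : BiMag S} (D : NatSystem C.Ob) {f : C.Hom X Y} {g : C.Hom W Z}
    (a : C.Hom W X) (b : C.Hom Y Z) (h : C.comp a (C.comp f b) = g) (ξ : D.grp f) :
    trivialExtension.mk D g ((D.map (X := ⟨f⟩) (Y := ⟨g⟩) ⟨a, b, h⟩).hom ξ) =
      (trivialExtension D).comp (trivialExtension.mk D a 0)
        ((trivialExtension D).comp (trivialExtension.mk D f ξ) (trivialExtension.mk D b 0)) := by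
  rw [trivialExtension.mk_comp_mk_zero D rfl, trivialExtension.mk_zero_comp_mk D h]
  refine congrArg (trivialExtension.mk D g) ?_
  have e := D.map_comp (X := ⟨f⟩) (Y := ⟨C.comp f b⟩) (Z := ⟨g⟩)
    ⟨𝟙 _, b, C.id_comp (C.comp f b)⟩
    ⟨a, 𝟙 _, (congrArg (C.comp a) (C.comp_id (C.comp f b))).trans h⟩
  refine Eq.trans ?_ (congrArg (fun m => m.hom ξ) e)
  refine congrArg (fun m => (D.map (X := ⟨f⟩) (Y := ⟨g⟩) m).hom ξ) (Factorization.Hom.ext ?_ ?_)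
  · exact (C.comp_id a).symm
  · exact (C.comp_id b).symm

/-- `D` is isomorphic to the natural system of fibres of `D ⋊ C ⟶ C`. -/
noncomputable def unitIso (D : CCNat C) : D ≅ (toBeckModule D).toCCNat :=
  ObjectProperty.isoMk _ (NatIso.ofComponents (fun f => fibreIso D f.arrow) fun {f g} k =>
    AddCommGrpCat.hom_ext (AddMonoidHom.ext fun ξ => Subtype.ext
      (mk_map D.obj (f := f.arrow) (g := g.arrow) k.left k.right k.w ξ)))

end CCNat

namespace BeckModule

open SortedCCC CCNat

variable {S : Type u} {C : SortedCCC.{u, v} S} (M : BeckModule C)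

/-- The functor `D(p) ⋊ C ⟶ E` which is the identity on fibres. -/
noncomputable def counitFunctor :
    IdFunctor (trivialExtension M.fibreSystem) M.total.toCatOn where
  map t := val t.2
  map_id X := M.zero_id X
  map_comp {X Y Z} t s := by
    have h := congrArg Subtype.val (Fibre.comp_eq (M := M) (f := t.1) (g := s.1) t.2 s.2)
    refine Eq.trans (congrArg val ?_) h.symm
    exact congrArg₂ (· + ·) (val_injective (push_val s.1 rfl t.2))
      (val_injective (pull_val t.1 rfl s.2))

/-- An element of a fibre of `p` determines the morphism of `C` that it lies over. -/
theorem counitFunctor_map_injective {X Y : BiMag S} :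
    Function.Injective (M.counitFunctor.map : (trivialExtension M.fibreSystem).Hom X Y → _) := by
  rintro ⟨f, s⟩ ⟨g, t⟩ h
  obtain rfl : f = g := (Subtype.property s).symm.trans
    ((congrArg M.proj.functor.map h).trans (Subtype.property t))
  exact congrArg (Sigma.mk f) (val_injective h)

/-- The inverse of `counitFunctor`. -/
noncomputable def counitFunctorInv :
    IdFunctor M.total.toCatOn (trivialExtension M.fibreSystem) where
  map t := trivialExtension.mk M.fibreSystem (M.proj.functor.map t) (⟨t, rfl⟩ : M.Fibre _)
  map_id X := M.counitFunctor_map_injective (M.counitFunctor.map_id X).symm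
  map_comp t s := M.counitFunctor_map_injective (M.counitFunctor.map_comp
    (trivialExtension.mk M.fibreSystem (M.proj.functor.map t) (⟨t, rfl⟩ : M.Fibre _))
    (trivialExtension.mk M.fibreSystem (M.proj.functor.map s) (⟨s, rfl⟩ : M.Fibre _))).symm

/-- A Beck module is, over `C`, isomorphic to the trivial extension by its natural system of
fibres. -/
noncomputable def counitOverIso : extensionOver M.toCCNat ≅ M.X where
  hom := Over.homMk (SortedCCC.Mor.mk' (A := extension M.toCCNat) M.counitFunctor fun f =>
      M.zeroMor.map_ι f) (SortedCCC.hom_ext fun _ _ t => Subtype.property (Sigma.snd t))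
  inv := Over.homMk (SortedCCC.Mor.mk' (B := extension M.toCCNat) M.counitFunctorInv fun f =>
      M.counitFunctor_map_injective (M.zeroMor.map_ι f).symm) (SortedCCC.hom_ext fun _ _ _ => rfl)
  hom_inv_id := over_hom_ext fun _ _ _ => M.counitFunctor_map_injective rfl
  inv_hom_id := over_hom_ext fun _ _ _ => rfl

/-- The isomorphism `counitOverIso` respects the group structures. -/
noncomputable def counitIso : toBeckModule M.toCCNat ≅ M :=
  CommGrp.mkIso M.counitOverIso (over_hom_ext fun _ _ _ => rfl) (over_hom_ext fun X Y t => by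
    induction t using mkPair_induction M.toCCNat with | h f ξ η
    rfl)

end BeckModule

open SortedCCC CCNat BeckModule in
/-- The functors `D ↦ D ⋊ C` and `p ↦ D(p)` form an equivalence. -/
noncomputable def trivialExtensionEquivalence {S : Type u} (C : SortedCCC.{u, v} S) :
    CCNat C ≌ BeckModule C :=
  .mk (trivialExtensionFunctor C) (fibreFunctor C)
    (NatIso.ofComponents (fun D => unitIso D) fun _ => rfl)
    (NatIso.ofComponents (fun M => counitIso M) fun _ => CommGrp.hom_ext _ _
      (over_hom_ext fun _ _ _ => rfl))

theorem mainTheorem2 {S : Type u} (C : SortedCCC.{u, v} S) :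
    ∃ Ξ : CCNat C ≌ BeckModule C,
      Nonempty (TrivialExtensionComparison Ξ.functor) ∧ Nonempty (FibreComparison Ξ.inverse) :=
  ⟨trivialExtensionEquivalence C, ⟨trivialExtensionComparison C⟩, ⟨fibreComparison C⟩⟩
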